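/- **Setting.** Let $\Omega=[0,2\pi]^3$ and let $r>3/2$ be real. For a function $u$ on $\mathbb R^3$, $2\pi$-periodic in each variable and square integrable on $\Omega$, put $\hat u_k=\frac1{8\pi^3}\int_\Omega u(x)e^{-\mathrm i k\cdot x}\,dx$ for $k\in\mathbb Z^3$. Let $H^r_p(\Omega)$ be the space of such real $u$ with $\|u\|_r^2=\sum_{k}(1+|k|^2)^r|\hat u_k|^2<\infty$; for vector fields the squares of the norms of the components are added. Elements of $H^r_p(\Omega)$ are identified with their continuous representatives. For $\mu,\varepsilon,t_{end}>0$, let $\mathbf H,\mathbf E\in C^1([0,t_{end}];[H^r_p(\Omega)]^3)$ be an exact solution of the Maxwell curl equations $$\partial_t\mathbf H=-\tfrac1\mu\nabla\times\mathbf E,\qquad \partial_t\mathbf E=\tfrac1\varepsilon\nabla\times\mathbf H ,$$ where the curl is taken in the sense of periodic distributions, with initial values $\mathbf H_0=\mathbf H(0)$ and $\mathbf E_0=\mathbf E(0)$ in $[H^r_p(\Omega)]^3$. (The divergence equations $\nabla\cdot(\varepsilon\mathbf E)=0$ and $\nabla\cdot(\varepsilon\mathbf H)=0$ may or may not hold;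 they are not needed.) **Scheme.** Let $N\ge 2$ be even, $h=2\pi/N$, and take the collocation points $(x_j,y_k,z_l)=(jh,kh,lh)$, $0\le j,k,l<N$. Let $\widehat{\mathbf H}^0,\widehat{\mathbf E}^0$ be the componentwise three-dimensional discrete Fourier transforms (with kernel $e^{-2\pi\mathrm i(jj'+kk'+ll')/N}$) of the grid values of $\mathbf H_0,\mathbf E_0$. At the grid frequency $(j,k,l)$ let $(\omega_1,\omega_2,\omega_3)=(a_j,a_k,a_l)$, where $(a_0,\dots,a_{N-1})=(0,1,\dots,\tfrac N2-1,0,-\tfrac N2+1,\dots,-1)$, and set $\kappa=t_{end}/\sqrt{\mu\varepsilon}$, $\Psi=\kappa^2(\omega_1^2+\omega_2^2+\omega_3^2)$, $\rho_1=(\cosh\sqrt{-\Psi}-1)/\Psi$, $\rho_2=\sinh(\sqrt{-\Psi})/\sqrt{-\Psi}$, with $\sqrt{-\Psi}=\mathrm i\sqrt\Psi$. Put $$\mathbf C=\begin{pmatrix}1+\kappa^2(\omega_3^2+\omega_2^2)\rho_1&-\kappa^2\omega_2\omega_1\rho_1&-\kappa^2\omega_3\omega_1\rho_1\\-\kappa^2\omega_2\omega_1\rho_1&1+\kappa^2(\omega_3^2+\omega_1^2)\rho_1&-\kappa^2\omega_3\omega_2\rho_1\\-\kappa^2\omega_3\omega_1\rho_1&-\kappa^2\omega_3\omega_2\rho_1&1+\kappa^2(\omega_2^2+\omega_1^2)\rho_1\end{pmatrix},\quad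 \mathbf S=\mathrm i\kappa\rho_2\begin{pmatrix}0&-\omega_3&\omega_2\\\omega_3&0&-\omega_1\\-\omega_2&\omega_1&0\end{pmatrix}$$ (so $\mathbf C=I$ and $\mathbf S=0$ when $\Psi=0$). The one-step fully discrete scheme, with time step $\Delta t=t_{end}$, computes at every grid frequency $$\sqrt\mu\,\widehat{\mathbf H}^{t_{end}}=\sqrt\mu\,\mathbf C\widehat{\mathbf H}^0-\sqrt\varepsilon\,\mathbf S\widehat{\mathbf E}^0,\qquad \sqrt\varepsilon\,\widehat{\mathbf E}^{t_{end}}=\sqrt\varepsilon\,\mathbf C\widehat{\mathbf E}^0+\sqrt\mu\,\mathbf S\widehat{\mathbf H}^0,$$ and then obtains the grid fields $\mathbf H^{t_{end}},\mathbf E^{t_{end}}$ by the inverse discrete Fourier transform. Let $\|\mathbf U\|_N^2=N^{-3}\sum_{j,k,l}|\mathbf U_{j,k,l}|^2$ for a grid field $\mathbf U$; in $\|\mathbf H^{t_{end}}-\mathbf H(t_{end})\|_N$ the exact solution is evaluated at the collocation points. **Theorem (Convergence).** For every $r>3/2$ and every bound $M$ on the initial values there is a constant $C>0$, depending only on $r$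 and $M$, such that for all $\mu,\varepsilon,t_{end}>0$, all exact solutions as above with $\|\mathbf H_0\|_r\le M$ and $\|\mathbf E_0\|_r\le M$, and all even $N\ge2$, $$\Big(\mu\|\mathbf H^{t_{end}}-\mathbf H(t_{end})\|_N^2+\varepsilon\|\mathbf E^{t_{end}}-\mathbf E(t_{end})\|_N^2\Big)^{1/2}\le C(\sqrt\mu+\sqrt\varepsilon)N^{-r}.$$ In particular $C$ does not depend on $\Delta t=t_{end}$, on the mesh size $h$, on $N$, $\mu$ or $\varepsilon$, so no CFL condition is needed. -/

import Mathlib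

open Filter Topology MeasureTheory
open scoped Matrix Kronecker

noncomputable section

namespace MaxwellFourier

/-! ### Periodic Sobolev spaces on the cube `Ω = [0, 2π]³` -/

/-- Points `(x, y, z)` of space. -/
abbrev Point : Type := Fin 3 → ℝ

/-- Real vector fields `(U_x, U_y, U_z)`. -/
abbrev VField : Type := Point → Fin 3 → ℝ

/-- The periodicity cell `Ω = [0, 2π]³`. -/
def cell : Set Point := Set.Icc 0 (fun _ => 2 * Real.pi)

/-- `2π`-periodicity in each of the three variables. -/
def IsPeriodic {α : Type*} (f : Point → α) : Prop :=
  ∀ (x : Point) (i : Fin 3), f (x + Pi.single i (2 * Real.pi)) = f x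

/-- The Fourier coefficient `(8π³)⁻¹ ∫_Ω u(x) exp(-i k·x) dx`. -/
def fourierCoef (u : Point → ℝ) (k : Fin 3 → ℤ) : ℂ :=
  ((2 * Real.pi : ℝ) : ℂ)⁻¹ ^ 3 *
    ∫ x in cell, (u x : ℂ) * Complex.exp (-(Complex.I * ∑ i, ((k i : ℝ) * x i : ℝ)))

/-- The weighted term `(1 + |k|²)^r |û_k|²` of the squared `H^r` norm. -/
def sobolevTerm (r : ℝ) (u : Point → ℝ) (k : Fin 3 → ℤ) : ℝ :=
  (1 + ∑ i, (k i : ℝ) ^ 2) ^ r * ‖fourierCoef u k‖ ^ 2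

/-- Membership in `H^r_p(Ω)`, the `2π`-periodic Sobolev space of real order `r ≥ 0`. -/
structure MemSobolev (r : ℝ) (u : Point → ℝ) : Prop where
  periodic : IsPeriodic u
  memLp : MemLp u 2 (volume.restrict cell)
  summable : Summable (sobolevTerm r u)

/-- Membership in `[H^r_p(Ω)]³`. -/
def MemSobolevVec (r : ℝ) (U : VField) : Prop :=
  ∀ i, MemSobolev r (fun x => U x i)

/-- The norm of `[H^r_p(Ω)]³`. -/
def sobolevNorm (r : ℝ) (U : VField) : ℝ :=
  √(∑ i, ∑' k, sobolevTerm r (fun x => U x i) k)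

/-- `U ∈ C¹([0, T]; [H^r_p(Ω)]³)` with time derivative `V = ∂U/∂t` (one-sided at the end points),
both the limit of the difference quotients and the continuity of `V` being in the `H^r` norm. -/
structure IsC1Sobolev (r T : ℝ) (U V : ℝ → VField) : Prop where
  mem : ∀ t ∈ Set.Icc 0 T, MemSobolevVec r (U t)
  mem_deriv : ∀ t ∈ Set.Icc 0 T, MemSobolevVec r (V t)
  hasDeriv : ∀ t ∈ Set.Icc 0 T,
    Tendsto (fun s => sobolevNorm r ((s - t)⁻¹ • (U s - U t) - V t)) (𝓝[Set.Icc 0 T \ {t}] t) (𝓝 0)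
  continuous_deriv : ∀ t ∈ Set.Icc 0 T,
    Tendsto (fun s => sobolevNorm r (V s - V t)) (𝓝[Set.Icc 0 T] t) (𝓝 0)

/-! ### The Maxwell curl equations -/

/-- The partial derivative `∂φ_j / ∂x_i` of a differentiable vector field. -/
def pderiv (i : Fin 3) (φ : VField) (j : Fin 3) (x : Point) : ℝ :=
  fderiv ℝ (fun y => φ y j) x (Pi.single i 1)

/-- The curl of a differentiable vector field. -/
def curl (φ : VField) : VField := fun x =>
  ![pderiv 1 φ 2 x - pderiv 2 φ 1 x,
    pderiv 2 φ 0 x - pderiv 0 φ 2 x,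
    pderiv 0 φ 1 x - pderiv 1 φ 0 x]

/-- `K = curl U` in the sense of periodic distributions: `∫_Ω K · φ = ∫_Ω U · curl φ` for all smooth
periodic vector fields `φ`. -/
def IsWeakCurl (U K : VField) : Prop :=
  ∀ φ : VField, ContDiff ℝ (⊤ : ℕ∞) φ → IsPeriodic φ →
    ∫ x in cell, K x ⬝ᵥ φ x = ∫ x in cell, U x ⬝ᵥ curl φ x

/-- `(H, E)` is a solution of class `C¹([0, T]; [H^r_p(Ω)]³)` of the curl equations
`∂H/∂t = -(1/μ) curl E`, `∂E/∂t = (1/ε) curl H`. For each time the continuous representative of the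
Sobolev class is taken, so that point values make sense. -/
def IsMaxwellSolution (μ ε r T : ℝ) (H E : ℝ → VField) : Prop :=
  (∀ t ∈ Set.Icc 0 T, Continuous (H t) ∧ Continuous (E t)) ∧
  ∃ Ht Et : ℝ → VField,
    IsC1Sobolev r T H Ht ∧ IsC1Sobolev r T E Et ∧
    ∀ t ∈ Set.Icc 0 T, IsWeakCurl (E t) (-(μ • Ht t)) ∧ IsWeakCurl (H t) (ε • Et t)

/-! ### The fully discrete scheme -/

/-- Indices `(l, k, j)` of the nodes `(x_j, y_k, z_l)`, numbered from `0`; the order of the factors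
is that of the Kronecker products `F_{N_z} ⊗ F_{N_y} ⊗ F_{N_x}`. -/
abbrev Grid (N : ℕ) : Type := Fin N × Fin N × Fin N

/-- Three (complex) components at each grid index. -/
abbrev GridField (N : ℕ) : Type := Fin 3 → Grid N → ℂ

/-- The collocation point `(j h, k h, l h)` with `h = 2π / N`. -/
def node {N : ℕ} (p : Grid N) : Point :=
  ![(p.2.2 : ℕ) * (2 * Real.pi / N), (p.2.1 : ℕ) * (2 * Real.pi / N), (p.1 : ℕ) * (2 * Real.pi / N)]

/-- The values of a vector field at the collocation points. -/
def sample (N : ℕ) (U : VField) : GridField N := fun i p => (U (node p) i : ℂ)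

/-- The matrix of DFT coefficients `(exp(2πi/N))^{-jk}`. -/
def dft (N : ℕ) : Matrix (Fin N) (Fin N) ℂ :=
  Matrix.of fun j k => Complex.exp (-(2 * Real.pi * Complex.I / N) * ((j : ℕ) * (k : ℕ)))

/-- The inverse DFT matrix, with entries `N⁻¹ (exp(2πi/N))^{jk}`. -/
def idft (N : ℕ) : Matrix (Fin N) (Fin N) ℂ :=
  Matrix.of fun j k => (N : ℂ)⁻¹ * Complex.exp ((2 * Real.pi * Complex.I / N) * ((j : ℕ) * (k : ℕ)))

/-- Componentwise three-dimensional DFT of a grid field. -/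
def dft3 {N : ℕ} (U : GridField N) : GridField N :=
  fun i => (dft N ⊗ₖ (dft N ⊗ₖ dft N)) *ᵥ U i

/-- Componentwise three-dimensional inverse DFT of a grid field. -/
def idft3 {N : ℕ} (U : GridField N) : GridField N :=
  fun i => (idft N ⊗ₖ (idft N ⊗ₖ idft N)) *ᵥ U i

/-- The entries of `(0, 1, …, N/2 - 1, 0, -N/2 + 1, …, -2, -1)`. -/
def freq {N : ℕ} (j : Fin N) : ℝ :=
  if 2 * (j : ℕ) < N then (j : ℕ) else if 2 * (j : ℕ) = N then 0 else (j : ℕ) - (N : ℝ)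

/-- The diagonal entries at a grid index of `(Ω₁, Ω₂, Ω₃)`. -/
def freq3 {N : ℕ} (p : Grid N) : Fin 3 → ℝ := ![freq p.2.2, freq p.2.1, freq p.1]

/-- `Ψ = κ² (ω₁² + ω₂² + ω₃²)`. -/
def psi (κ : ℝ) (ω : Fin 3 → ℝ) : ℝ := κ ^ 2 * (ω 0 ^ 2 + ω 1 ^ 2 + ω 2 ^ 2)

/-- `(cosh √(-Ψ) - 1) / Ψ`, with `√(-Ψ) = i √Ψ`. Where `Ψ = 0` the value is irrelevant, since it is
multiplied by `0`. -/
def coshQuot (κ : ℝ) (ω : Fin 3 → ℝ) : ℂ :=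
  (Complex.cosh (Complex.I * (√(psi κ ω) : ℝ)) - 1) / (psi κ ω : ℝ)

/-- `sinh √(-Ψ) / √(-Ψ)`, with `√(-Ψ) = i √Ψ`. Where `Ψ = 0` the value is irrelevant, since it is
multiplied by `0`. -/
def sinhQuot (κ : ℝ) (ω : Fin 3 → ℝ) : ℂ :=
  Complex.sinh (Complex.I * (√(psi κ ω) : ℝ)) / (Complex.I * (√(psi κ ω) : ℝ))

/-- The symmetric matrix of the coefficients `c₁₁, …, c₃₃` at one frequency. -/
def cosCoef (κ : ℝ) (ω : Fin 3 → ℝ) : Matrix (Fin 3) (Fin 3) ℂ :=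
  let c11 : ℂ := 1 + κ ^ 2 * (ω 2 ^ 2 + ω 1 ^ 2) * coshQuot κ ω
  let c22 : ℂ := 1 + κ ^ 2 * (ω 2 ^ 2 + ω 0 ^ 2) * coshQuot κ ω
  let c33 : ℂ := 1 + κ ^ 2 * (ω 1 ^ 2 + ω 0 ^ 2) * coshQuot κ ω
  let c12 : ℂ := -(κ ^ 2 * ω 1 * ω 0 * coshQuot κ ω)
  let c13 : ℂ := -(κ ^ 2 * ω 2 * ω 0 * coshQuot κ ω)
  let c23 : ℂ := -(κ ^ 2 * ω 2 * ω 1 * coshQuot κ ω)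
  !![c11, c12, c13;
     c12, c22, c23;
     c13, c23, c33]

/-- The skew-symmetric matrix of the coefficients `s₁₂, s₁₃, s₂₃` at one frequency. -/
def sinCoef (κ : ℝ) (ω : Fin 3 → ℝ) : Matrix (Fin 3) (Fin 3) ℂ :=
  let s12 : ℂ := Complex.I * κ * ω 2 * sinhQuot κ ω
  let s13 : ℂ := Complex.I * κ * ω 1 * sinhQuot κ ω
  let s23 : ℂ := Complex.I * κ * ω 0 * sinhQuot κ ω
  !![0, -s12, s13;
     s12, 0, -s23;
     -s13, s23, 0]

/-- `H^T`: the magnetic field at the collocation points computed by one step of size `T`. -/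
def schemeH (μ ε T : ℝ) (N : ℕ) (H₀ E₀ : VField) : GridField N :=
  let κ : ℝ := T / √(μ * ε)
  let Hhat : GridField N := dft3 (sample N H₀)
  let Ehat : GridField N := dft3 (sample N E₀)
  idft3 fun i p =>
    (√μ : ℂ)⁻¹ * (√μ * (cosCoef κ (freq3 p) *ᵥ fun a => Hhat a p) i
      - √ε * (sinCoef κ (freq3 p) *ᵥ fun a => Ehat a p) i)

/-- `E^T`: the electric field at the collocation points computed by one step of size `T`. -/
def schemeE (μ ε T : ℝ) (N : ℕ) (H₀ E₀ : VField) : GridField N :=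
  let κ : ℝ := T / √(μ * ε)
  let Hhat : GridField N := dft3 (sample N H₀)
  let Ehat : GridField N := dft3 (sample N E₀)
  idft3 fun i p =>
    (√ε : ℂ)⁻¹ * (√ε * (cosCoef κ (freq3 p) *ᵥ fun a => Ehat a p) i
      + √μ * (sinCoef κ (freq3 p) *ᵥ fun a => Hhat a p) i)

/-- The squared discrete norm `‖U‖_N² = N⁻³ ∑ |U(x_j, y_k, z_l)|²`. -/
def discreteNormSq {N : ℕ} (U : GridField N) : ℝ :=
  1 / (N : ℝ) ^ 3 * ∑ i, ∑ p, ‖U i p‖ ^ 2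

end MaxwellFourier

end

open MaxwellFourier

/-!
The scheme is exact in time at each frequency, so that its error is an aliasing error.

Write `J(ω) = i [ω]×` for the symbol of the curl. Testing the weak equations with `cos(k · x) e_j`
and `sin(k · x) e_j` shows (`IsWeakCurl.fourierCoef_eq`) that the scaled Fourier coefficients
`u = √μ Ĥ_k`, `v = √ε Ê_k` of an exact solution satisfy `u' = -c J(k) v`, `v' = c J(k) u` with
`c = 1 / √(με)`. Since `J³ = |k|² J`, the matrices of the scheme are `cos(κ J)` and `sin(κ J)`
(`cosCoef_eq`, `sinCoef_eq`), and they propagate `(u, v)` exactly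
(`IsMaxwellSolution.fourierVec_eq`). Their entries are bounded independently of `κ` and of the
frequency; this is why neither the time step nor `μ`, `ε` enter the constant.

For `r > 3/2` the Fourier series of the continuous representatives converge absolutely
(`hasSum_fourierCoef`), so the discrete Fourier coefficient of grid values at the grid index `q` is
`N³` times the sum of the coefficients at the frequencies `k = q + N m` (`sample_eq_idft3`). The
scheme applies to this sum the propagator at the grid frequency `ω_q`, whereas the exact solution
carries the propagator at `k` in each term. The terms with `k = ω_q` cancel; all others, including
those at the frequencies `N / 2` which the scheme replaces by `0`, satisfy `|k| ≥ N / 2`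
(`freq3_eq_or_sq_le_weight`). For them `(1 + |k|²)^(-r) ≤ 30^r N^(-2r) (1 + |m|²)^(-r)`, and
Cauchy–Schwarz in `m` bounds the square of the error at `q` by a constant times `N^(-2r)` times the
part of `μ ‖H₀‖_r² + ε ‖E₀‖_r²` that lives on the class of `q` (`aliasTail_sq_le`). The discrete
Parseval identity (`discreteNormSq_idft3`) adds up these bounds.
-/

namespace MaxwellFourier

/-! ### The propagator at one frequency -/

/-- The Hermitian matrix `J(ω) = i [ω]×`: the symbol of the curl at the frequency `ω`. -/
def curlSymbol (ω : Fin 3 → ℝ) : Matrix (Fin 3) (Fin 3) ℂ :=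
  !![0, -(Complex.I * ω 2), Complex.I * ω 1;
     Complex.I * ω 2, 0, -(Complex.I * ω 0);
     -(Complex.I * ω 1), Complex.I * ω 0, 0]

/-- The Euclidean length `|ω|`. -/
noncomputable def freqNorm (ω : Fin 3 → ℝ) : ℝ := √(ω 0 ^ 2 + ω 1 ^ 2 + ω 2 ^ 2)

lemma freqNorm_nonneg (ω : Fin 3 → ℝ) : 0 ≤ freqNorm ω := Real.sqrt_nonneg _

lemma freqNorm_sq (ω : Fin 3 → ℝ) : freqNorm ω ^ 2 = ω 0 ^ 2 + ω 1 ^ 2 + ω 2 ^ 2 :=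
  Real.sq_sqrt (by positivity)

lemma sqrt_psi (s : ℝ) (ω : Fin 3 → ℝ) : √(psi s ω) = |s| * freqNorm ω := by
  rw [psi, freqNorm, Real.sqrt_mul (sq_nonneg s), Real.sqrt_sq_eq_abs]

/-- The identity includes the degenerate cases `s = 0` and `ω = 0`, where both sides are `0`. -/
lemma sq_mul_coshQuot (s : ℝ) (ω : Fin 3 → ℝ) :
    (s : ℂ) ^ 2 * coshQuot s ω =
      (((Real.cos (s * freqNorm ω) - 1) / freqNorm ω ^ 2 : ℝ) : ℂ) := by
  have h1 : Complex.cosh (Complex.I * ((√(psi s ω) : ℝ) : ℂ)) =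
      ((Real.cos (s * freqNorm ω) : ℝ) : ℂ) := by
    rw [mul_comm, Complex.cosh_mul_I, sqrt_psi, ← Complex.ofReal_cos]
    congr 1
    rw [← Real.cos_abs (s * freqNorm ω), abs_mul, abs_of_nonneg (freqNorm_nonneg ω)]
  have h2 : psi s ω = s ^ 2 * freqNorm ω ^ 2 := by rw [freqNorm_sq, psi]
  rw [coshQuot, h1, h2]
  rcases eq_or_ne s 0 with rfl | hs
  · simp
  · have : (s : ℂ) ≠ 0 := by exact_mod_cast hs
    push_cast
    field_simp

/-- The identity includes the degenerate cases `s = 0` and `ω = 0`, where both sides are `0`. -/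
lemma mul_sinhQuot (s : ℝ) (ω : Fin 3 → ℝ) :
    (s : ℂ) * sinhQuot s ω = ((Real.sin (s * freqNorm ω) / freqNorm ω : ℝ) : ℂ) := by
  rw [sinhQuot, mul_comm Complex.I, Complex.sinh_mul_I, mul_div_mul_right _ _ Complex.I_ne_zero,
    sqrt_psi, ← Complex.ofReal_sin, ← Complex.ofReal_div, ← Complex.ofReal_mul]
  congr 1
  rcases lt_trichotomy s 0 with hs | rfl | hs
  · rw [abs_of_neg hs, neg_mul, Real.sin_neg, neg_div_neg_eq]
    have := hs.ne
    field_simp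
  · simp
  · rw [abs_of_pos hs]
    have := hs.ne'
    field_simp

/-- The cosine matrix is `cos(s J)`, written as a polynomial in `J` by means of `J³ = |ω|² J`. -/
lemma cosCoef_eq (s : ℝ) (ω : Fin 3 → ℝ) :
    cosCoef s ω = 1 + (((Real.cos (s * freqNorm ω) - 1) / freqNorm ω ^ 2 : ℝ) : ℂ) •
      (curlSymbol ω * curlSymbol ω) := by
  rw [← sq_mul_coshQuot]
  ext i j
  fin_cases i <;> fin_cases j <;>
    simp [cosCoef, curlSymbol] <;>
    ring_nf <;> simp [Complex.I_sq]

/-- The sine matrix is `sin(s J)`. -/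
lemma sinCoef_eq (s : ℝ) (ω : Fin 3 → ℝ) :
    sinCoef s ω = ((Real.sin (s * freqNorm ω) / freqNorm ω : ℝ) : ℂ) • curlSymbol ω := by
  rw [← mul_sinhQuot]
  ext i j
  fin_cases i <;> fin_cases j <;> simp [sinCoef, curlSymbol] <;> ring

lemma curlSymbol_cube (ω : Fin 3 → ℝ) :
    curlSymbol ω * (curlSymbol ω * curlSymbol ω) = ((freqNorm ω ^ 2 : ℝ) : ℂ) • curlSymbol ω := by
  rw [freqNorm_sq]
  ext i j
  fin_cases i <;> fin_cases j <;>
    simp [curlSymbol, Matrix.mul_apply, Fin.sum_univ_three] <;>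
    ring_nf <;> simp [Complex.I_pow_three] <;> ring

lemma norm_curlSymbol_apply_le (ω : Fin 3 → ℝ) (i j : Fin 3) :
    ‖curlSymbol ω i j‖ ≤ freqNorm ω := by
  have h (a : Fin 3) : |ω a| ≤ freqNorm ω := by
    apply Real.abs_le_sqrt
    fin_cases a <;> simp <;> nlinarith [sq_nonneg (ω 0), sq_nonneg (ω 1), sq_nonneg (ω 2)]
  fin_cases i <;> fin_cases j <;> simp [curlSymbol, freqNorm_nonneg, h]

lemma norm_curlSymbol_sq_apply_le (ω : Fin 3 → ℝ) (i j : Fin 3) :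
    ‖(curlSymbol ω * curlSymbol ω) i j‖ ≤ 3 * freqNorm ω ^ 2 := by
  rw [Matrix.mul_apply]
  refine (norm_sum_le _ _).trans ?_
  refine (Finset.sum_le_card_nsmul _ _ (freqNorm ω ^ 2) fun a _ => ?_).trans (by simp)
  rw [norm_mul, sq]
  exact mul_le_mul (norm_curlSymbol_apply_le ω i a) (norm_curlSymbol_apply_le ω a j)
    (norm_nonneg _) (freqNorm_nonneg ω)

lemma norm_sinCoef_apply_le (s : ℝ) (ω : Fin 3 → ℝ) (i j : Fin 3) : ‖sinCoef s ω i j‖ ≤ 1 := by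
  rw [sinCoef_eq, Matrix.smul_apply, norm_smul, Complex.norm_real, norm_div, Real.norm_eq_abs,
    Real.norm_of_nonneg (freqNorm_nonneg ω)]
  calc |Real.sin (s * freqNorm ω)| / freqNorm ω * ‖curlSymbol ω i j‖
      ≤ 1 / freqNorm ω * freqNorm ω :=
        mul_le_mul (div_le_div_of_nonneg_right (Real.abs_sin_le_one _) (freqNorm_nonneg ω))
          (norm_curlSymbol_apply_le ω i j) (norm_nonneg _)
          (by have := freqNorm_nonneg ω; positivity)
    _ ≤ 1 := by rw [one_div]; exact inv_mul_le_one

lemma norm_cosCoef_apply_le (s : ℝ) (ω : Fin 3 → ℝ) (i j : Fin 3) : ‖cosCoef s ω i j‖ ≤ 7 := by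
  rw [cosCoef_eq, Matrix.add_apply, Matrix.smul_apply]
  refine (norm_add_le _ _).trans ?_
  have h1 : ‖(1 : Matrix (Fin 3) (Fin 3) ℂ) i j‖ ≤ 1 := by
    rw [Matrix.one_apply]; split_ifs <;> simp
  rw [norm_smul, Complex.norm_real, norm_div, Real.norm_eq_abs, norm_pow,
    Real.norm_of_nonneg (freqNorm_nonneg ω)]
  have h2 : |Real.cos (s * freqNorm ω) - 1| ≤ 2 := by
    rw [abs_le]
    constructor <;>
      linarith [Real.cos_le_one (s * freqNorm ω), Real.neg_one_le_cos (s * freqNorm ω)]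
  have h3 : |Real.cos (s * freqNorm ω) - 1| / freqNorm ω ^ 2 *
      ‖(curlSymbol ω * curlSymbol ω) i j‖ ≤ 2 / freqNorm ω ^ 2 * (3 * freqNorm ω ^ 2) :=
    mul_le_mul (div_le_div_of_nonneg_right h2 (sq_nonneg _)) (norm_curlSymbol_sq_apply_le ω i j)
      (norm_nonneg _) (by positivity)
  have h4 : 2 / freqNorm ω ^ 2 * (3 * freqNorm ω ^ 2) ≤ 6 := by
    have := inv_mul_le_one (a := freqNorm ω ^ 2)
    rw [div_eq_mul_inv]; nlinarith
  linarith

/-! ### The curl system at one frequency -/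

/-- Solution formula for `u' = -c J v`, `v' = c J u` where `J³ = n² J`: the formula holds because
`t ↦ cos((T - t) c J) u(t) - sin((T - t) c J) v(t)` has derivative zero. For `n = 0` the quotients
by `n` are `0`, which is harmless since then `J = 0` is required. -/
lemma first_component_of_hasDerivWithinAt {F : Type*} [NormedAddCommGroup F] [NormedSpace ℝ F]
    (J : F →L[ℝ] F) {n c T : ℝ} (hT : 0 < T) (hJ : ∀ x, J (J (J x)) = n ^ 2 • J x)
    (hn : n = 0 → J = 0) {u v : ℝ → F}
    (hu : ∀ t ∈ Set.Icc 0 T, HasDerivWithinAt u (-(c • J (v t))) (Set.Icc 0 T) t)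
    (hv : ∀ t ∈ Set.Icc 0 T, HasDerivWithinAt v (c • J (u t)) (Set.Icc 0 T) t) :
    u T = u 0 + ((Real.cos (c * T * n) - 1) / n ^ 2) • J (J (u 0))
      - (Real.sin (c * T * n) / n) • J (v 0) := by
  set φ : ℝ → F := fun t => u t + ((Real.cos (c * (T - t) * n) - 1) / n ^ 2) • J (J (u t))
      - (Real.sin (c * (T - t) * n) / n) • J (v t) with hφ
  have key : ∀ t ∈ Set.Icc 0 T, HasDerivWithinAt φ 0 (Set.Icc 0 T) t := by
    intro t ht
    have h0 : HasDerivAt (fun t : ℝ => c * (T - t) * n) (-(c * n)) t := by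
      have := (((hasDerivAt_id t).const_sub T).const_mul c).mul_const n
      simpa using this
    have h1 := ((h0.cos.sub_const 1).div_const (n ^ 2)).hasDerivWithinAt (s := Set.Icc 0 T)
    have h2 := (h0.sin.div_const n).hasDerivWithinAt (s := Set.Icc 0 T)
    have h3 := J.hasFDerivAt.comp_hasDerivWithinAt t (hu t ht)
    have h3' := J.hasFDerivAt.comp_hasDerivWithinAt t h3
    have h4 := J.hasFDerivAt.comp_hasDerivWithinAt t (hv t ht)
    have h5 := ((hu t ht).add (h1.smul h3')).sub (h2.smul h4)
    refine h5.congr_deriv ?_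
    rcases eq_or_ne n 0 with h | h
    · simp [hn h]
    · simp only [Function.comp, map_neg, map_smul, hJ]
      match_scalars <;> field_simp <;> ring
  have hconst : φ T = φ 0 := by
    refine (convex_Icc (0 : ℝ) T).is_const_of_fderivWithin_eq_zero (𝕜 := ℝ)
      (fun t ht => (key t ht).differentiableWithinAt) (fun t ht => ?_)
      (Set.right_mem_Icc.2 hT.le) (Set.left_mem_Icc.2 hT.le)
    rw [(key t ht).hasFDerivWithinAt.fderivWithin (uniqueDiffOn_Icc hT t ht)]
    ext; simp
  simpa [hφ] using hconst

lemma curlSymbol_eq_zero {ω : Fin 3 → ℝ} (h : freqNorm ω = 0) : curlSymbol ω = 0 := by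
  ext i j
  have := norm_curlSymbol_apply_le ω i j
  rw [h] at this
  simpa using le_antisymm this (norm_nonneg _)

lemma cosCoef_sub_sinCoef_of_hasDerivWithinAt (ω : Fin 3 → ℝ) {c T : ℝ} (hT : 0 < T)
    {u v : ℝ → Fin 3 → ℂ}
    (hu : ∀ t ∈ Set.Icc 0 T,
      HasDerivWithinAt u (-(c • (curlSymbol ω *ᵥ v t))) (Set.Icc 0 T) t)
    (hv : ∀ t ∈ Set.Icc 0 T, HasDerivWithinAt v (c • (curlSymbol ω *ᵥ u t)) (Set.Icc 0 T) t) :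
    u T = cosCoef (c * T) ω *ᵥ u 0 - sinCoef (c * T) ω *ᵥ v 0 := by
  set J : (Fin 3 → ℂ) →L[ℝ] (Fin 3 → ℂ) :=
    LinearMap.toContinuousLinearMap ((Matrix.mulVecLin (curlSymbol ω)).restrictScalars ℝ) with hJ
  have hJa (x) : J x = curlSymbol ω *ᵥ x := rfl
  have := first_component_of_hasDerivWithinAt J (n := freqNorm ω) (c := c) hT
    (fun x => by
      simp only [hJa, Matrix.mulVec_mulVec, curlSymbol_cube, Matrix.smul_mulVec]
      simp [← Complex.coe_smul])
    (fun h => by ext x; simp [hJa, curlSymbol_eq_zero h]) hu hv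
  rw [this, cosCoef_eq, sinCoef_eq]
  simp only [hJa, Matrix.add_mulVec, Matrix.one_mulVec, Matrix.smul_mulVec, Matrix.mulVec_mulVec,
    Complex.coe_smul]

/-! ### Fourier coefficients and the Sobolev norm -/

/-- The phase `k · x`. -/
def phase (k : Fin 3 → ℤ) (x : Point) : ℝ := ∑ i, (k i : ℝ) * x i

lemma contDiff_phase (k : Fin 3 → ℤ) : ContDiff ℝ (⊤ : ℕ∞) (phase k) := by
  unfold phase; fun_prop

lemma continuous_phase (k : Fin 3 → ℤ) : Continuous (phase k) := (contDiff_phase k).continuous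

lemma fourierCoef_eq (u : Point → ℝ) (k : Fin 3 → ℤ) :
    fourierCoef u k = ((2 * Real.pi : ℝ) : ℂ)⁻¹ ^ 3 *
      ∫ x in cell, (u x : ℂ) * Complex.exp (-(Complex.I * (phase k x : ℂ))) := by
  simp [fourierCoef, phase]

instance isFiniteMeasure_restrict_cell : IsFiniteMeasure (volume.restrict cell) :=
  ⟨by rw [Measure.restrict_apply_univ]; exact isCompact_Icc.measure_lt_top⟩

lemma integrable_mul_exp {u : Point → ℝ} (hu : Integrable u (volume.restrict cell))
    (k : Fin 3 → ℤ) :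
    Integrable (fun x => (u x : ℂ) * Complex.exp (-(Complex.I * (phase k x : ℂ))))
      (volume.restrict cell) := by
  have hc := continuous_phase k
  refine hu.ofReal.mul_bdd (c := 1) (by fun_prop) (ae_of_all _ fun x => ?_)
  rw [Complex.norm_exp]
  simp

lemma fourierCoef_sub {u v : Point → ℝ} (hu : Integrable u (volume.restrict cell))
    (hv : Integrable v (volume.restrict cell)) (k : Fin 3 → ℤ) :
    fourierCoef (fun x => u x - v x) k = fourierCoef u k - fourierCoef v k := by
  simp only [fourierCoef_eq]
  rw [← mul_sub, ← integral_sub (integrable_mul_exp hu k) (integrable_mul_exp hv k)]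
  simp [sub_mul]

lemma fourierCoef_smul (c : ℝ) (u : Point → ℝ) (k : Fin 3 → ℤ) :
    fourierCoef (fun x => c * u x) k = c * fourierCoef u k := by
  simp only [fourierCoef_eq]
  simp only [Complex.ofReal_mul, mul_assoc, integral_const_mul]
  ring

lemma MemSobolev.integrable {r : ℝ} {u : Point → ℝ} (hu : MemSobolev r u) :
    Integrable u (volume.restrict cell) :=
  hu.memLp.integrable (by norm_num)

lemma sobolevTerm_nonneg (r : ℝ) (u : Point → ℝ) (k : Fin 3 → ℤ) : 0 ≤ sobolevTerm r u k :=
  mul_nonneg (Real.rpow_nonneg (by positivity) _) (sq_nonneg _)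

lemma MemSobolev.const_mul {r : ℝ} {u : Point → ℝ} (hu : MemSobolev r u) (c : ℝ) :
    MemSobolev r (fun x => c * u x) where
  periodic x i := by simp only [hu.periodic x i]
  memLp := hu.memLp.const_mul c
  summable := by
    refine (hu.summable.mul_left (c ^ 2)).congr fun k => ?_
    simp only [sobolevTerm, fourierCoef_smul, norm_mul, mul_pow, Complex.norm_real,
      Real.norm_eq_abs, sq_abs]
    ring

lemma MemSobolev.sub {r : ℝ} {u v : Point → ℝ} (hu : MemSobolev r u) (hv : MemSobolev r v) :
    MemSobolev r (fun x => u x - v x) where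
  periodic x i := by simp only [hu.periodic x i, hv.periodic x i]
  memLp := hu.memLp.sub hv.memLp
  summable := by
    refine Summable.of_nonneg_of_le (sobolevTerm_nonneg r _) (fun k => ?_)
      ((hu.summable.mul_left 2).add (hv.summable.mul_left 2))
    have h1 : ‖fourierCoef u k - fourierCoef v k‖ ^ 2 ≤
        2 * ‖fourierCoef u k‖ ^ 2 + 2 * ‖fourierCoef v k‖ ^ 2 := by
      have := norm_sub_le (fourierCoef u k) (fourierCoef v k)
      nlinarith [norm_nonneg (fourierCoef u k - fourierCoef v k),
        sq_nonneg (‖fourierCoef u k‖ - ‖fourierCoef v k‖)]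
    have h2 : 0 ≤ (1 + ∑ i, (k i : ℝ) ^ 2) ^ r := Real.rpow_nonneg (by positivity) _
    simp only [sobolevTerm, fourierCoef_sub hu.integrable hv.integrable]
    nlinarith [mul_le_mul_of_nonneg_left h1 h2]

lemma sum_sobolevTerm_le_sobolevNorm_sq {r : ℝ} {U : VField} (i : Fin 3) :
    ∑' k, sobolevTerm r (fun x => U x i) k ≤ sobolevNorm r U ^ 2 := by
  have h (i : Fin 3) : 0 ≤ ∑' k, sobolevTerm r (fun x => U x i) k :=
    tsum_nonneg (sobolevTerm_nonneg r _)
  rw [sobolevNorm, Real.sq_sqrt (Finset.sum_nonneg fun i _ => h i)]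
  exact Finset.single_le_sum (f := fun i => ∑' k, sobolevTerm r (fun x => U x i) k)
    (fun i _ => h i) (Finset.mem_univ i)

lemma norm_fourierCoef_le_sobolevNorm {r : ℝ} (hr : 0 ≤ r) {U : VField} (hU : MemSobolevVec r U)
    (i : Fin 3) (k : Fin 3 → ℤ) : ‖fourierCoef (fun x => U x i) k‖ ≤ sobolevNorm r U := by
  refine le_of_sq_le_sq ?_ (Real.sqrt_nonneg _)
  calc ‖fourierCoef (fun x => U x i) k‖ ^ 2 ≤ sobolevTerm r (fun x => U x i) k :=
        le_mul_of_one_le_left (sq_nonneg _)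
          (Real.one_le_rpow (le_add_of_nonneg_right (by positivity)) hr)
    _ ≤ ∑' k, sobolevTerm r (fun x => U x i) k :=
        (hU i).summable.le_tsum k fun _ _ => sobolevTerm_nonneg r _ _
    _ ≤ sobolevNorm r U ^ 2 := sum_sobolevTerm_le_sobolevNorm_sq i

/-- Convergence of difference quotients in `H^r` implies convergence of each coefficient, since
`|û_k| ≤ ‖u‖_r`. -/
lemma IsC1Sobolev.hasDerivWithinAt_fourierCoef {r T : ℝ} (hr : 0 ≤ r) {U V : ℝ → VField}
    (h : IsC1Sobolev r T U V) (i : Fin 3) (k : Fin 3 → ℤ) {t : ℝ} (ht : t ∈ Set.Icc 0 T) :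
    HasDerivWithinAt (fun s => fourierCoef (fun x => U s x i) k)
      (fourierCoef (fun x => V t x i) k) (Set.Icc 0 T) t := by
  rw [hasDerivWithinAt_iff_tendsto_slope, tendsto_iff_norm_sub_tendsto_zero]
  refine squeeze_zero' (Eventually.of_forall fun _ => norm_nonneg _) ?_ (h.hasDeriv t ht)
  filter_upwards [self_mem_nhdsWithin] with s hs
  have h1 (i : Fin 3) := ((h.mem s hs.1 i).sub (h.mem t ht i))
  have h2 (i : Fin 3) := (h1 i).const_mul (s - t)⁻¹
  have h3 : MemSobolevVec r ((s - t)⁻¹ • (U s - U t) - V t) := fun i =>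
    (h2 i).sub (h.mem_deriv t ht i)
  refine le_trans (le_of_eq ?_) (norm_fourierCoef_le_sobolevNorm hr h3 i k)
  congr 1
  have h4 := fourierCoef_sub (h2 i).integrable (h.mem_deriv t ht i).integrable k
  rw [fourierCoef_smul,
    fourierCoef_sub (h.mem s hs.1 i).integrable (h.mem t ht i).integrable] at h4
  rw [slope_def_module]
  simpa [Algebra.smul_def] using h4.symm

/-! ### The Fourier coefficients of a weak curl -/

lemma fourierCoef_eq_cos_sub_sin {u : Point → ℝ} (hu : Integrable u (volume.restrict cell))
    (k : Fin 3 → ℤ) :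
    fourierCoef u k = ((2 * Real.pi : ℝ) : ℂ)⁻¹ ^ 3 *
      ((∫ x in cell, u x * Real.cos (phase k x) : ℝ) -
        Complex.I * (∫ x in cell, u x * Real.sin (phase k x) : ℝ)) := by
  have hc := continuous_phase k
  have h1 : Integrable (fun x => u x * Real.cos (phase k x)) (volume.restrict cell) :=
    hu.mul_bdd (c := 1) (by fun_prop) (ae_of_all _ fun x => Real.abs_cos_le_one _)
  have h2 : Integrable (fun x => u x * Real.sin (phase k x)) (volume.restrict cell) :=
    hu.mul_bdd (c := 1) (by fun_prop) (ae_of_all _ fun x => Real.abs_sin_le_one _)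
  have h3 := integral_sub h1.ofReal (h2.ofReal.const_mul Complex.I)
  simp only [RCLike.ofReal_eq_complex_ofReal, integral_const_mul] at h3
  rw [fourierCoef_eq, ← integral_complex_ofReal, ← integral_complex_ofReal, ← h3]
  congr 2
  ext x
  rw [mul_comm Complex.I, ← neg_mul, Complex.exp_mul_I]
  push_cast
  rw [Complex.cos_neg, Complex.sin_neg]
  ring

lemma periodic_phase (k : Fin 3 → ℤ) (x : Point) (i : Fin 3) :
    phase k (x + Pi.single i (2 * Real.pi)) = phase k x + k i * (2 * Real.pi) := by
  simp [phase, mul_add, Finset.sum_add_distrib, Pi.single_apply]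

/-- The curl of `g(k · x) e_j` is `g'(k · x) (k × e_j)`, where `(k × e_j)_a = -Im J(k)_{ja}`. -/
lemma curl_single_comp_phase {g g' : ℝ → ℝ} (hg : ∀ s, HasDerivAt g (g' s) s) (k : Fin 3 → ℤ)
    (j a : Fin 3) (x : Point) :
    curl (fun y => Pi.single j (g (phase k y))) x a =
      -(g' (phase k x) * (curlSymbol (fun i => (k i : ℝ)) j a).im) := by
  have hp (i b : Fin 3) : pderiv i (fun y => Pi.single j (g (phase k y))) b x =
      if b = j then g' (phase k x) * k i else 0 := by
    rw [pderiv]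
    split_ifs with h
    · subst h
      have h1 : HasFDerivAt (phase k)
          (∑ i, (k i : ℝ) • ContinuousLinearMap.proj (R := ℝ) (φ := fun _ : Fin 3 => ℝ) i) x := by
        unfold phase
        exact HasFDerivAt.fun_sum fun i _ => (hasFDerivAt_apply i x).const_mul (k i : ℝ)
      have h2 := ((hg _).comp_hasFDerivAt x h1).fderiv
      simp only [Pi.single_eq_same]
      change (fderiv ℝ (g ∘ phase k) x) _ = _
      rw [h2]
      simp [Pi.single_apply]
    · simp [Pi.single_eq_of_ne h]
  fin_cases j <;> simp only [Fin.zero_eta, Fin.mk_one, Fin.reduceFinMk] at hp <;>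
    fin_cases a <;> simp [curl, hp, curlSymbol]

/-- The weak curl tested with the field `g(k · x) e_j`. -/
lemma IsWeakCurl.integral_mul_comp_phase {U K : VField} (h : IsWeakCurl U K)
    (hU : ∀ i, Integrable (fun x => U x i) (volume.restrict cell)) {g g' : ℝ → ℝ}
    (hg : ∀ s, HasDerivAt g (g' s) s) (hsm : ContDiff ℝ (⊤ : ℕ∞) g)
    (hper : Function.Periodic g (2 * Real.pi)) (hcont : Continuous g') (hbd : ∀ s, |g' s| ≤ 1)
    (k : Fin 3 → ℤ) (j : Fin 3) :
    ∫ x in cell, K x j * g (phase k x) =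
      -∑ a, (curlSymbol (fun i => (k i : ℝ)) j a).im * ∫ x in cell, U x a * g' (phase k x) := by
  have hc := continuous_phase k
  have hi (a : Fin 3) : Integrable (fun x => U x a * g' (phase k x)) (volume.restrict cell) :=
    (hU a).mul_bdd (c := 1) (by fun_prop) (ae_of_all _ fun x => hbd _)
  have h1 := h (fun y => Pi.single j (g (phase k y)))
    (contDiff_pi.2 fun b => by
      rcases eq_or_ne b j with rfl | hb
      · simp only [Pi.single_eq_same]
        exact hsm.comp (contDiff_phase k)
      · simpa [Pi.single_eq_of_ne hb] using contDiff_const)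
    (fun x i => by
      simp only [periodic_phase]
      rw [(hper.int_mul (k i)) (phase k x)])
  simp only [dotProduct_single] at h1
  rw [h1, ← Finset.sum_neg_distrib]
  simp only [← integral_const_mul, ← integral_neg]
  have h2 := integral_finsetSum Finset.univ (μ := volume.restrict cell)
    (f := fun a x => -((curlSymbol (fun i => (k i : ℝ)) j a).im * (U x a * g' (phase k x))))
    fun a _ => ((hi a).const_mul _).neg
  rw [← h2]
  congr 1
  ext x
  simp only [dotProduct, curl_single_comp_phase hg]
  refine Finset.sum_congr rfl fun a _ => ?_
  ring

/-- The weak curl acts on Fourier coefficients by its symbol: the test fields `cos(k · x) e_j` and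
`sin(k · x) e_j` give, up to sign, the real and imaginary parts of the kernel
`exp(-i k · x)`. -/
lemma IsWeakCurl.fourierCoef_eq {U K : VField} (h : IsWeakCurl U K)
    (hU : ∀ i, Integrable (fun x => U x i) (volume.restrict cell))
    (hK : ∀ i, Integrable (fun x => K x i) (volume.restrict cell)) (k : Fin 3 → ℤ) :
    (fun j => fourierCoef (fun x => K x j) k) =
      curlSymbol (fun i => (k i : ℝ)) *ᵥ fun j => fourierCoef (fun x => U x j) k := by
  ext j
  have h1 := h.integral_mul_comp_phase hU (g := Real.cos) (g' := fun s => -Real.sin s)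
    Real.hasDerivAt_cos Real.contDiff_cos Real.cos_periodic (by fun_prop)
    (fun s => by simpa using Real.abs_sin_le_one s) k j
  have h2 := h.integral_mul_comp_phase hU (g := Real.sin) (g' := Real.cos)
    Real.hasDerivAt_sin Real.contDiff_sin Real.sin_periodic Real.continuous_cos
    Real.abs_cos_le_one k j
  have hJ (a : Fin 3) : curlSymbol (fun i => (k i : ℝ)) j a =
      Complex.I * ((curlSymbol (fun i => (k i : ℝ)) j a).im : ℂ) := by
    fin_cases j <;> fin_cases a <;> simp [curlSymbol]
  simp only [mul_neg, integral_neg, Finset.sum_neg_distrib, neg_neg] at h1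
  rw [fourierCoef_eq_cos_sub_sin (hK j), h1, h2, Matrix.mulVec, dotProduct]
  simp only [fourierCoef_eq_cos_sub_sin (hU _)]
  push_cast
  rw [mul_neg, sub_neg_eq_add, mul_add, Finset.mul_sum, Finset.mul_sum, Finset.mul_sum,
    ← Finset.sum_add_distrib]
  refine Finset.sum_congr rfl fun a _ => ?_
  rw [hJ a]
  simp only [Complex.mul_im, Complex.I_re, Complex.I_im, Complex.ofReal_re, Complex.ofReal_im]
  ring_nf
  simp [Complex.I_sq]
  ring

/-! ### Evolution of the Fourier coefficients of a solution -/

/-- The vector of the Fourier coefficients of the three components. -/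
noncomputable def fourierVec (U : VField) (k : Fin 3 → ℤ) : Fin 3 → ℂ :=
  fun i => fourierCoef (fun x => U x i) k

lemma fourierVec_smul (c : ℝ) (U : VField) (k : Fin 3 → ℤ) :
    fourierVec (c • U) k = c • fourierVec U k := by
  ext i
  simpa [fourierVec] using fourierCoef_smul c (fun x => U x i) k

lemma IsC1Sobolev.hasDerivWithinAt_fourierVec {r T : ℝ} (hr : 0 ≤ r) {U V : ℝ → VField}
    (h : IsC1Sobolev r T U V) (k : Fin 3 → ℤ) {t : ℝ} (ht : t ∈ Set.Icc 0 T) :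
    HasDerivWithinAt (fun s => fourierVec (U s) k) (fourierVec (V t) k) (Set.Icc 0 T) t :=
  hasDerivWithinAt_pi.2 fun i => h.hasDerivWithinAt_fourierCoef hr i k ht

lemma IsWeakCurl.fourierVec_eq {r : ℝ} {U K : VField} (h : IsWeakCurl U K)
    (hU : MemSobolevVec r U) (hK : MemSobolevVec r K) (k : Fin 3 → ℤ) :
    fourierVec K k = curlSymbol (fun i => (k i : ℝ)) *ᵥ fourierVec U k :=
  h.fourierCoef_eq (fun i => (hU i).integrable) (fun i => (hK i).integrable) k

/-- In the scaled unknowns `√μ Ĥ_k`, `√ε Ê_k` the equations become `u' = -c J v`, `v' = c J u` with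
`c = 1 / √(με)`, so that the exact solution is propagated by the matrices of the scheme, taken at
the true frequency `k`. -/
lemma IsMaxwellSolution.fourierVec_eq {μ ε r T : ℝ} (hμ : 0 < μ) (hε : 0 < ε) (hr : 0 ≤ r)
    (hT : 0 < T) {H E : ℝ → VField} (h : IsMaxwellSolution μ ε r T H E) (k : Fin 3 → ℤ) :
    √μ • fourierVec (H T) k =
        cosCoef (T / √(μ * ε)) (fun i => (k i : ℝ)) *ᵥ (√μ • fourierVec (H 0) k) -
        sinCoef (T / √(μ * ε)) (fun i => (k i : ℝ)) *ᵥ (√ε • fourierVec (E 0) k) ∧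
      √ε • fourierVec (E T) k =
        cosCoef (T / √(μ * ε)) (fun i => (k i : ℝ)) *ᵥ (√ε • fourierVec (E 0) k) +
        sinCoef (T / √(μ * ε)) (fun i => (k i : ℝ)) *ᵥ (√μ • fourierVec (H 0) k) := by
  obtain ⟨-, Ht, Et, hH, hE, hw⟩ := h
  set c : ℝ := (√(μ * ε))⁻¹ with hc
  set J := curlSymbol (fun i => (k i : ℝ)) with hJ
  have hsμ : √μ ≠ 0 := (Real.sqrt_pos.2 hμ).ne'
  have hsε : √ε ≠ 0 := (Real.sqrt_pos.2 hε).ne'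
  have hc' : c = (√μ)⁻¹ * (√ε)⁻¹ := by rw [hc, Real.sqrt_mul hμ.le, mul_inv]
  have hTc : T / √(μ * ε) = c * T := by rw [hc, div_eq_inv_mul]
  have hu : ∀ t ∈ Set.Icc 0 T, HasDerivWithinAt (fun t => √μ • fourierVec (H t) k)
      (-(c • (J *ᵥ (√ε • fourierVec (E t) k)))) (Set.Icc 0 T) t := by
    intro t ht
    refine ((hH.hasDerivWithinAt_fourierVec hr k ht).const_smul √μ).congr_deriv ?_
    have hm : MemSobolevVec r (-(μ • Ht t)) := fun i => by
      simpa using (hH.mem_deriv t ht i).const_mul (-μ)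
    have h1 := (hw t ht).1.fourierVec_eq (hE.mem t ht) hm k
    rw [← neg_smul, fourierVec_smul] at h1
    rw [Matrix.mulVec_smul, ← h1, hc', smul_smul, smul_smul, ← neg_smul]
    congr 1
    field_simp
    rw [Real.sq_sqrt hμ.le]
  have hv : ∀ t ∈ Set.Icc 0 T, HasDerivWithinAt (fun t => √ε • fourierVec (E t) k)
      (c • (J *ᵥ (√μ • fourierVec (H t) k))) (Set.Icc 0 T) t := by
    intro t ht
    refine ((hE.hasDerivWithinAt_fourierVec hr k ht).const_smul √ε).congr_deriv ?_
    have hm : MemSobolevVec r (ε • Et t) := fun i => (hE.mem_deriv t ht i).const_mul ε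
    have h1 := (hw t ht).2.fourierVec_eq (hH.mem t ht) hm k
    rw [fourierVec_smul] at h1
    rw [Matrix.mulVec_smul, ← h1, hc', smul_smul, smul_smul]
    congr 1
    field_simp
    rw [Real.sq_sqrt hε.le]
  rw [hTc]
  refine ⟨cosCoef_sub_sinCoef_of_hasDerivWithinAt _ hT hu hv, ?_⟩
  -- The second formula is the first one for the pair `(v, -u)`, which solves the same system.
  have h2 := cosCoef_sub_sinCoef_of_hasDerivWithinAt (fun i => (k i : ℝ)) hT
    (v := fun t => -(√μ • fourierVec (H t) k)) (u := fun t => √ε • fourierVec (E t) k)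
    (fun t ht => (hv t ht).congr_deriv (by rw [Matrix.mulVec_neg, smul_neg, neg_neg]))
    (fun t ht => (hu t ht).neg.congr_deriv (neg_neg _))
  simpa only [Matrix.mulVec_neg, sub_neg_eq_add] using h2

/-! ### Pointwise Fourier inversion -/

lemma IsPeriodic.add_int {α : Type*} {u : Point → α} (hu : IsPeriodic u) (x : Point)
    (m : Fin 3 → ℤ) : u (x + (2 * Real.pi) • (fun i => (m i : ℝ))) = u x := by
  have h (i : Fin 3) (n : ℤ) (x : Point) :
      u (x + n • (Pi.single i (2 * Real.pi) : Point)) = u x :=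
    Function.Periodic.zsmul (f := u) (fun x => hu x i) n x
  have e : (2 * Real.pi) • (fun i => (m i : ℝ)) = m 0 • (Pi.single 0 (2 * Real.pi) : Point) +
      m 1 • (Pi.single 1 (2 * Real.pi) : Point) + m 2 • (Pi.single 2 (2 * Real.pi) : Point) := by
    ext i
    fin_cases i <;> simp [mul_comm]
  rw [e, ← add_assoc, ← add_assoc, h, h, h]

/-- The function on the torus `(ℝ / ℤ)³` induced by a `2π`-periodic function. -/
noncomputable def toTorus (u : Point → ℝ) (y : UnitAddTorus (Fin 3)) : ℂ :=
  u ((2 * Real.pi) • fun i => ((AddCircle.equivIco 1 0 (y i) : ℝ)))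

lemma IsPeriodic.toTorus_coe {u : Point → ℝ} (hu : IsPeriodic u) (x : Point) :
    toTorus u (fun i => (x i : UnitAddCircle)) = u ((2 * Real.pi) • x) := by
  have h (i : Fin 3) : ∃ m : ℤ, (AddCircle.equivIco 1 0 (x i : UnitAddCircle) : ℝ) + m = x i := by
    refine ⟨⌊x i⌋, ?_⟩
    have := AddCircle.coe_equivIco_mk_apply (1 : ℝ) (x i)
    simp only [this, div_one, mul_one, Int.fract_add_floor]
  choose m hm using h
  rw [toTorus, ← hu.add_int _ m, ← smul_add]
  congr 3
  ext i
  exact hm i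

lemma IsPeriodic.continuous_toTorus {u : Point → ℝ} (hu : IsPeriodic u) (hc : Continuous u) :
    Continuous (toTorus u) := by
  have hq : IsOpenQuotientMap (Pi.map fun (_ : Fin 3) (x : ℝ) => (x : UnitAddCircle)) :=
    IsOpenQuotientMap.piMap fun _ => QuotientAddGroup.isOpenQuotientMap_mk
  rw [hq.isQuotientMap.continuous_iff]
  have : toTorus u ∘ (Pi.map fun (_ : Fin 3) (x : ℝ) => (x : UnitAddCircle)) =
      fun x => (u ((2 * Real.pi) • x) : ℂ) := funext fun x => hu.toTorus_coe x
  rw [this]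
  fun_prop

lemma mFourier_coe (k : Fin 3 → ℤ) (x : Point) :
    UnitAddTorus.mFourier k (fun i => (x i : UnitAddCircle)) =
      Complex.exp (Complex.I * (phase k ((2 * Real.pi) • x) : ℂ)) := by
  simp only [UnitAddTorus.mFourier, ContinuousMap.coe_mk, fourier_coe_apply, ← Complex.exp_sum,
    phase]
  congr 1
  push_cast
  rw [Finset.mul_sum]
  refine Finset.sum_congr rfl fun i _ => ?_
  simp
  ring

open scoped Pointwise in
lemma cell_ae_eq :
    (cell : Set Point) =ᵐ[volume]
      (2 * Real.pi) • {x : Point | ∀ i, x i ∈ Set.Ioc ((0 : Point) i) ((0 : Point) i + 1)} := by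
  have h : (2 * Real.pi) • {x : Point | ∀ i, x i ∈ Set.Ioc ((0 : Point) i) ((0 : Point) i + 1)} =
      Set.univ.pi fun i => Set.Ioc ((0 : Point) i) (2 * Real.pi) := by
    have hp := Real.two_pi_pos
    ext x
    rw [Set.mem_smul_set_iff_inv_smul_mem₀ hp.ne']
    simp only [Set.mem_ofPred_eq, Set.mem_univ_pi, Pi.smul_apply, smul_eq_mul, Pi.zero_apply,
      zero_add, Set.mem_Ioc, inv_mul_le_iff₀ hp, mul_one, inv_pos, mul_pos_iff_of_pos_left, hp]
  rw [h, cell]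
  exact (Measure.univ_pi_Ioc_ae_eq_Icc (μ := fun _ : Fin 3 => (volume : Measure ℝ))).symm

open scoped Pointwise in
lemma IsPeriodic.mFourierCoeff_toTorus {u : Point → ℝ} (hu : IsPeriodic u) (k : Fin 3 → ℤ) :
    UnitAddTorus.mFourierCoeff (toTorus u) k = fourierCoef u k := by
  rw [UnitAddTorus.mFourierCoeff_eq_integral _ _ 0, fourierCoef_eq,
    setIntegral_congr_set cell_ae_eq]
  have h := Measure.setIntegral_comp_smul (μ := (volume : Measure Point))
    (fun x => (u x : ℂ) * Complex.exp (-(Complex.I * (phase k x : ℂ)))) (R := 2 * Real.pi)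
    {x : Point | ∀ i, x i ∈ Set.Ioc ((0 : Point) i) ((0 : Point) i + 1)}
    Real.two_pi_pos.ne'
  have e : ∀ x : Point, UnitAddTorus.mFourier (-k) (fun i => (x i : UnitAddCircle)) •
      toTorus u (fun i => (x i : UnitAddCircle)) = (u ((2 * Real.pi) • x) : ℂ) *
        Complex.exp (-(Complex.I * (phase k ((2 * Real.pi) • x) : ℂ))) := by
    intro x
    rw [mFourier_coe, hu.toTorus_coe, smul_eq_mul, mul_comm]
    simp [phase]
  simp only [e]
  rw [h, abs_of_pos (by positivity)]
  simp only [Module.finrank_fin_fun, Complex.real_smul]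
  push_cast
  rw [inv_pow]

/-- Where the coefficients are absolutely summable, the Fourier series converges at every point to
the continuous representative. -/
lemma hasSum_fourierCoef {u : Point → ℝ} (hu : IsPeriodic u) (hc : Continuous u)
    (hs : Summable (fourierCoef u)) (x : Point) :
    HasSum (fun k => fourierCoef u k * Complex.exp (Complex.I * (phase k x : ℂ))) (u x : ℂ) := by
  have e : UnitAddTorus.mFourierCoeff (⟨toTorus u, hu.continuous_toTorus hc⟩ :
      C(UnitAddTorus (Fin 3), ℂ)) = fourierCoef u := funext fun k => hu.mFourierCoeff_toTorus k
  have h := UnitAddTorus.hasSum_mFourier_series_apply_of_summable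
    (f := ⟨toTorus u, hu.continuous_toTorus hc⟩) (by rw [e]; exact hs)
    (fun i => (((2 * Real.pi)⁻¹ • x) i : UnitAddCircle))
  simpa only [hu.mFourierCoeff_toTorus, ContinuousMap.coe_mk, mFourier_coe, hu.toTorus_coe,
    smul_inv_smul₀ Real.two_pi_pos.ne', smul_eq_mul] using h

/-! ### The discrete Fourier transform and aliasing -/

lemma idft_eq_pow {N : ℕ} (j k : Fin N) :
    idft N j k = (N : ℂ)⁻¹ * Complex.exp (2 * Real.pi * Complex.I / N) ^ ((j : ℕ) * (k : ℕ)) := by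
  rw [idft, Matrix.of_apply, ← Complex.exp_nat_mul]
  push_cast
  rw [mul_comm (2 * (Real.pi : ℂ) * Complex.I / N)]

lemma dft_eq_pow {N : ℕ} (j k : Fin N) :
    dft N j k = (Complex.exp (2 * Real.pi * Complex.I / N))⁻¹ ^ ((j : ℕ) * (k : ℕ)) := by
  rw [dft, Matrix.of_apply, ← Complex.exp_neg, ← Complex.exp_nat_mul]
  push_cast
  congr 1
  ring

lemma idft_mul_dft (N : ℕ) : idft N * dft N = 1 := by
  rcases Nat.eq_zero_or_pos N with rfl | hN
  · ext i; exact i.elim0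
  have hζ := Complex.isPrimitiveRoot_exp N hN.ne'
  set ζ := Complex.exp (2 * Real.pi * Complex.I / N) with hζd
  have hN0 : (N : ℂ) ≠ 0 := by exact_mod_cast hN.ne'
  ext j k
  have h1 (l : Fin N) : idft N j l * dft N l k =
      (N : ℂ)⁻¹ * (ζ ^ (j : ℕ) * (ζ ^ (k : ℕ))⁻¹) ^ (l : ℕ) := by
    rw [idft_eq_pow, dft_eq_pow, mul_pow, ← pow_mul, inv_pow, inv_pow, ← pow_mul,
      mul_comm (k : ℕ), mul_assoc]
  rw [Matrix.mul_apply]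
  simp only [h1, ← Finset.mul_sum]
  rw [Fin.sum_univ_eq_sum_range (fun l => (ζ ^ (j : ℕ) * (ζ ^ (k : ℕ))⁻¹) ^ l)]
  have hk0 : ζ ^ (k : ℕ) ≠ 0 := pow_ne_zero _ (Complex.exp_ne_zero _)
  rcases eq_or_ne j k with rfl | hjk
  · simp [mul_inv_cancel₀ hk0, hN0]
  · rw [Matrix.one_apply_ne hjk]
    have hw : ζ ^ (j : ℕ) * (ζ ^ (k : ℕ))⁻¹ ≠ 1 := fun h =>
      hjk (Fin.ext (hζ.pow_inj j.2 k.2 ((mul_inv_eq_one₀ hk0).1 h)))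
    rw [geom_sum_eq hw, mul_pow, inv_pow, ← pow_mul, ← pow_mul, mul_comm (j : ℕ),
      mul_comm (k : ℕ), pow_mul, pow_mul, hζ.pow_eq_one]
    simp

lemma conjTranspose_idft (N : ℕ) : (idft N)ᴴ = (N : ℂ)⁻¹ • dft N := by
  ext j k
  rw [Matrix.conjTranspose_apply, idft, dft, Matrix.smul_apply, Matrix.of_apply, Matrix.of_apply,
    star_mul', Complex.star_def, ← Complex.exp_conj]
  simp only [map_mul, map_inv₀, map_div₀, Complex.conj_natCast, Complex.conj_I, map_ofNat,
    Complex.conj_ofReal, smul_eq_mul]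
  congr 2
  ring

lemma idft_kronecker_mul_dft_kronecker (N : ℕ) :
    (idft N ⊗ₖ (idft N ⊗ₖ idft N)) * (dft N ⊗ₖ (dft N ⊗ₖ dft N)) = 1 := by
  rw [← Matrix.mul_kronecker_mul, ← Matrix.mul_kronecker_mul, idft_mul_dft,
    Matrix.one_kronecker_one, Matrix.one_kronecker_one]

lemma dft3_idft3 {N : ℕ} (Y : GridField N) : dft3 (idft3 Y) = Y := by
  ext i p
  rw [dft3, idft3, Matrix.mulVec_mulVec,
    mul_eq_one_comm.1 (idft_kronecker_mul_dft_kronecker N), Matrix.one_mulVec]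

/-- Discrete Parseval identity, with the normalization that suits Fourier coefficients. -/
lemma discreteNormSq_idft3 {N : ℕ} (hN : 0 < N) (Y : GridField N) :
    discreteNormSq (idft3 ((N : ℂ) ^ 3 • Y)) = ∑ i, ∑ p, ‖Y i p‖ ^ 2 := by
  have hN0 : (N : ℂ) ≠ 0 := by exact_mod_cast hN.ne'
  have hN1 : (N : ℝ) ≠ 0 := by exact_mod_cast hN.ne'
  set D := idft N ⊗ₖ (idft N ⊗ₖ idft N) with hD
  have hDD : Dᴴ * D = ((N : ℂ)⁻¹ ^ 3) • 1 := by
    rw [hD, Matrix.conjTranspose_kronecker, Matrix.conjTranspose_kronecker, conjTranspose_idft,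
      ← mul_eq_one_comm.1 (idft_kronecker_mul_dft_kronecker N)]
    simp only [Matrix.smul_kronecker, Matrix.kronecker_smul, smul_smul, Matrix.smul_mul]
    congr 1
    ring
  have key (v : Grid N → ℂ) :
      ∑ p, ‖(D *ᵥ ((N : ℂ) ^ 3 • v)) p‖ ^ 2 = (N : ℝ) ^ 3 * ∑ p, ‖v p‖ ^ 2 := by
    have hn (w : Grid N → ℂ) : ((∑ p, ‖w p‖ ^ 2 : ℝ) : ℂ) = star w ⬝ᵥ w := by
      simp only [dotProduct, Pi.star_apply, Complex.star_def, Complex.conj_mul']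
      push_cast
      rfl
    apply Complex.ofReal_injective
    rw [Complex.ofReal_mul, hn, hn, Matrix.star_mulVec, Matrix.dotProduct_mulVec,
      Matrix.vecMul_vecMul, hDD, ← Matrix.dotProduct_mulVec, Matrix.smul_mulVec,
      Matrix.one_mulVec, smul_smul, ← mul_pow, inv_mul_cancel₀ hN0, one_pow, one_smul]
    simp
  rw [discreteNormSq, Finset.mul_sum]
  refine Finset.sum_congr rfl fun i _ => ?_
  have : (fun p => ‖idft3 ((N : ℂ) ^ 3 • Y) i p‖ ^ 2) =
      fun p => ‖(D *ᵥ ((N : ℂ) ^ 3 • Y i)) p‖ ^ 2 := rfl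
  rw [this, key]
  field_simp

/-- The components of a grid index, in the order of the space variables. -/
def gridIdx {N : ℕ} (q : Grid N) : Fin 3 → Fin N := ![q.2.2, q.2.1, q.1]

/-- The frequencies `q + N m` that coincide on the grid with the grid index `q`. -/
def aliasFreq {N : ℕ} (q : Grid N) (m : Fin 3 → ℤ) : Fin 3 → ℤ :=
  fun i => (gridIdx q i : ℕ) + N * m i

lemma aliasFreq_bijective {N : ℕ} (hN : 0 < N) :
    Function.Bijective fun x : Grid N × (Fin 3 → ℤ) => aliasFreq x.1 x.2 := by
  have hN' : (0 : ℤ) < N := by exact_mod_cast hN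
  constructor
  · rintro ⟨q, m⟩ ⟨q', m'⟩ h
    have h1 (i : Fin 3) : gridIdx q i = gridIdx q' i ∧ m i = m' i := by
      have hi : ((gridIdx q i : ℕ) : ℤ) + N * m i = (gridIdx q' i : ℕ) + N * m' i := congrFun h i
      have b1 : ((gridIdx q i : ℕ) : ℤ) < N := by exact_mod_cast (gridIdx q i).2
      have b2 : ((gridIdx q' i : ℕ) : ℤ) < N := by exact_mod_cast (gridIdx q' i).2
      have e := congrArg (· / (N : ℤ)) hi
      simp only [Int.add_mul_ediv_left _ _ hN'.ne',
        Int.ediv_eq_zero_of_lt (Int.natCast_nonneg _) b1,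
        Int.ediv_eq_zero_of_lt (Int.natCast_nonneg _) b2, zero_add] at e
      rw [e] at hi
      exact ⟨Fin.ext (by exact_mod_cast add_right_cancel hi), e⟩
    have h2 : m = m' := funext fun i => (h1 i).2
    have h3 : q = q' := Prod.ext (h1 2).1 (Prod.ext (h1 1).1 (h1 0).1)
    rw [h2, h3]
  · intro k
    let f (i : Fin 3) : Fin N := ⟨(k i % N).toNat, by
      have := Int.emod_lt_of_pos (k i) hN'
      have := Int.emod_nonneg (k i) hN'.ne'
      omega⟩
    refine ⟨((f 2, f 1, f 0), fun i => k i / N), ?_⟩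
    have hf (i : Fin 3) : ((f i : ℕ) : ℤ) = k i % N :=
      Int.toNat_of_nonneg (Int.emod_nonneg _ hN'.ne')
    ext i
    have h : gridIdx ((f 2, f 1, f 0) : Grid N) i = f i := by fin_cases i <;> rfl
    simp only [aliasFreq, h, hf]
    exact Int.emod_add_mul_ediv _ _

lemma exp_phase_aliasFreq_node {N : ℕ} (hN : 0 < N) (q p : Grid N) (m : Fin 3 → ℤ) :
    Complex.exp (Complex.I * (phase (aliasFreq q m) (node p) : ℂ)) =
      (N : ℂ) ^ 3 * (idft N ⊗ₖ (idft N ⊗ₖ idft N)) p q := by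
  have hN0 : (N : ℂ) ≠ 0 := by exact_mod_cast hN.ne'
  have h1 : (N : ℂ) ^ 3 * (idft N ⊗ₖ (idft N ⊗ₖ idft N)) p q =
      Complex.exp ((2 * Real.pi * Complex.I / N) * ((p.1 : ℕ) * (q.1 : ℕ) +
        (p.2.1 : ℕ) * (q.2.1 : ℕ) + (p.2.2 : ℕ) * (q.2.2 : ℕ))) := by
    simp only [Matrix.kroneckerMap_apply, idft, Matrix.of_apply, mul_add, Complex.exp_add]
    field_simp
  rw [h1, Complex.exp_eq_exp_iff_exists_int]
  refine ⟨p.2.2 * m 0 + p.2.1 * m 1 + p.1 * m 2, ?_⟩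
  simp only [phase, aliasFreq, node, gridIdx, Fin.sum_univ_three, Matrix.cons_val_zero,
    Matrix.cons_val_one, Matrix.cons_val]
  push_cast
  field_simp
  ring

/-- The grid values of a function are the inverse DFT of the sums of its Fourier coefficients over
the classes of aliased frequencies. -/
lemma sample_eq_idft3 {N : ℕ} (hN : 0 < N) {U : VField} (hp : ∀ i, IsPeriodic fun x => U x i)
    (hc : ∀ i, Continuous fun x => U x i)
    (hs : ∀ i, Summable (fourierCoef fun x => U x i)) :
    sample N U = 
      idft3 ((N : ℂ) ^ 3 • (fun i q => ∑' m, fourierVec U (aliasFreq q m) i : GridField N)) := by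
  ext i p
  let e := Equiv.ofBijective _ (aliasFreq_bijective hN)
  have h1 := e.hasSum_iff.2 (hasSum_fourierCoef (hp i) (hc i) (hs i) (node p))
  have h2 (q : Grid N) : HasSum (fun m => fourierVec U (aliasFreq q m) i *
      Complex.exp (Complex.I * (phase (aliasFreq q m) (node p) : ℂ)))
      ((∑' m, fourierVec U (aliasFreq q m) i) *
        ((N : ℂ) ^ 3 * (idft N ⊗ₖ (idft N ⊗ₖ idft N)) p q)) := by
    simp only [exp_phase_aliasFreq_node hN]
    exact ((e.summable_iff.2 (hs i)).prod_factor q).hasSum.mul_right _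
  have h3 := (h1.prod_fiberwise h2).unique (hasSum_fintype _)
  rw [sample, h3, idft3, Matrix.mulVec, dotProduct]
  refine Finset.sum_congr rfl fun q _ => ?_
  simp only [Pi.smul_apply, smul_eq_mul]
  ring

/-! ### Lattice sums and the aliasing estimate -/

/-- The Sobolev weight `1 + |k|²`. -/
def weight (k : Fin 3 → ℤ) : ℝ := 1 + ∑ i, (k i : ℝ) ^ 2

lemma one_le_weight (k : Fin 3 → ℤ) : 1 ≤ weight k :=
  le_add_of_nonneg_right (by positivity)

lemma weight_pos (k : Fin 3 → ℤ) : 0 < weight k := zero_lt_one.trans_le (one_le_weight k)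

lemma summable_one_add_sq_rpow {s : ℝ} (hs : 1 / 2 < s) :
    Summable fun n : ℤ => (1 + (n : ℝ) ^ 2) ^ (-s) := by
  have h := Real.summable_abs_int_rpow (b := 2 * s) (by linarith)
  refine Summable.of_norm_bounded_eventually h ?_
  filter_upwards [(Set.finite_singleton (0 : ℤ)).compl_mem_cofinite] with n hn
  have hn' : (n : ℝ) ≠ 0 := by exact_mod_cast hn
  rw [Real.norm_of_nonneg (Real.rpow_nonneg (by positivity) _),
    show -(2 * s) = (2 : ℕ) * (-s) by push_cast; ring, Real.rpow_natCast_mul (abs_nonneg _), sq_abs]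
  exact Real.rpow_le_rpow_of_nonpos (by positivity) (by linarith) (by linarith)

/-- The condition `r > 3/2` enters here: `(1 + |m|²)³` dominates the product of the `1 + m_i²`, so
that the sum is at most a product of three convergent sums over `ℤ`. -/
lemma summable_weight_rpow {r : ℝ} (hr : 3 / 2 < r) :
    Summable fun m : Fin 3 → ℤ => weight m ^ (-r) := by
  have h1 := summable_one_add_sq_rpow (s := r / 3) (by linarith)
  have h0 (n : ℤ) : 0 ≤ (1 + (n : ℝ) ^ 2) ^ (-(r / 3)) := Real.rpow_nonneg (by positivity) _
  have h2 := h1.mul_of_nonneg h1 h0 h0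
  have h3 := h1.mul_of_nonneg h2 h0 fun x => mul_nonneg (h0 _) (h0 _)
  have hinj : Function.Injective fun m : Fin 3 → ℤ => (m 0, m 1, m 2) := by
    intro m m' h
    simp only [Prod.mk.injEq] at h
    ext i
    fin_cases i
    exacts [h.1, h.2.1, h.2.2]
  refine Summable.of_nonneg_of_le (fun m => Real.rpow_nonneg (weight_pos m).le _) (fun m => ?_)
    (h3.comp_injective hinj)
  have hw (i : Fin 3) : weight m ^ (-(r / 3)) ≤ (1 + (m i : ℝ) ^ 2) ^ (-(r / 3)) := by
    refine Real.rpow_le_rpow_of_nonpos (by positivity) ?_ (by linarith)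
    have := Finset.single_le_sum (f := fun i => (m i : ℝ) ^ 2) (fun i _ => sq_nonneg _)
      (Finset.mem_univ i)
    simp only [weight]
    linarith
  have hsplit : weight m ^ (-r) =
      weight m ^ (-(r / 3)) * (weight m ^ (-(r / 3)) * weight m ^ (-(r / 3))) := by
    rw [← Real.rpow_add (weight_pos m), ← Real.rpow_add (weight_pos m)]
    congr 1
    ring
  have hp : 0 ≤ weight m ^ (-(r / 3)) := Real.rpow_nonneg (weight_pos m).le _
  rw [hsplit]
  exact mul_le_mul (hw 0) (mul_le_mul (hw 1) (hw 2) hp (h0 _)) (by positivity) (h0 _)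

/-- A frequency that coincides on the grid with `q` and is not the frequency that the scheme uses
there has a component of modulus at least `N / 2`. -/
lemma freq3_eq_or_sq_le_weight {N : ℕ} (q : Grid N) (m : Fin 3 → ℤ) :
    (fun i => (aliasFreq q m i : ℝ)) = freq3 q ∨ (N : ℝ) ^ 2 ≤ 4 * weight (aliasFreq q m) := by
  by_cases h : ∃ i, (N : ℤ) ≤ 2 * |aliasFreq q m i|
  · right
    obtain ⟨i, hi⟩ := h
    have h1 : (N : ℝ) ≤ 2 * |(aliasFreq q m i : ℝ)| := by exact_mod_cast hi
    have h2 := Finset.single_le_sum (f := fun i => (aliasFreq q m i : ℝ) ^ 2)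
      (fun i _ => sq_nonneg _) (Finset.mem_univ i)
    have h3 := pow_le_pow_left₀ (Nat.cast_nonneg N) h1 2
    rw [mul_pow, sq_abs] at h3
    simp only [weight]
    linarith
  · left
    push Not at h
    have hfreq (i : Fin 3) : (aliasFreq q m i : ℝ) = freq (gridIdx q i) := by
      have h1 : 2 * |((gridIdx q i : ℕ) : ℤ) + N * m i| < N := h i
      have h2 : ((gridIdx q i : ℕ) : ℤ) < N := by exact_mod_cast (gridIdx q i).2
      have h3 : (0 : ℤ) ≤ ((gridIdx q i : ℕ) : ℤ) := Int.natCast_nonneg _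
      rw [aliasFreq, freq]
      obtain ⟨h4, h5⟩ := abs_lt.1 (show |2 * (((gridIdx q i : ℕ) : ℤ) + N * m i)| < N by
        rwa [abs_mul, abs_two])
      -- Both `q_i` in `[0, N)` and `|k_i| < N / 2` leave only `k_i = q_i` and `k_i = q_i - N`.
      have h6 : -2 < m i := by nlinarith
      have h7 : m i < 1 := by nlinarith
      have h8 : m i = 0 ∨ m i = -1 := by omega
      rcases h8 with h8 | h8
      · rw [h8] at h5
        have : 2 * (gridIdx q i : ℕ) < N := by omega
        simp [h8, this]
      · rw [h8] at h4
        have h9 : ¬ 2 * (gridIdx q i : ℕ) < N := by omega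
        have h10 : ¬ 2 * (gridIdx q i : ℕ) = N := by omega
        simp [h8, h9, h10, sub_eq_add_neg]
    ext i
    rw [hfreq]
    fin_cases i <;> rfl

/-- On such a frequency the Sobolev weight controls both `N²` and `|m|²`: `N m = k - q` with
`0 ≤ q_i < N` gives `N² |m|² ≤ 2 |k|² + 6 N²`, whence `N² (1 + |m|²) ≤ 7 N² + 2 |k|²`. -/
lemma sq_mul_weight_le {N : ℕ} (q : Grid N) (m : Fin 3 → ℤ)
    (h : (N : ℝ) ^ 2 ≤ 4 * weight (aliasFreq q m)) :
    (N : ℝ) ^ 2 * weight m ≤ 30 * weight (aliasFreq q m) := by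
  have h1 (i : Fin 3) : (N : ℝ) ^ 2 * (m i : ℝ) ^ 2 ≤
      2 * (aliasFreq q m i : ℝ) ^ 2 + 2 * (N : ℝ) ^ 2 := by
    have hq : ((gridIdx q i : ℕ) : ℝ) ≤ N := by exact_mod_cast (gridIdx q i).2.le
    have hq2 := pow_le_pow_left₀ (Nat.cast_nonneg _) hq 2
    have e : (N : ℝ) * m i = aliasFreq q m i - (gridIdx q i : ℕ) := by
      simp [aliasFreq]
    rw [← mul_pow, e]
    nlinarith [sq_nonneg ((aliasFreq q m i : ℝ) + (gridIdx q i : ℕ))]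
  have h2 := Finset.sum_le_sum fun i (_ : i ∈ Finset.univ) => h1 i
  rw [← Finset.mul_sum, Finset.sum_add_distrib, ← Finset.mul_sum] at h2
  simp only [Finset.sum_const, Finset.card_univ, Fintype.card_fin, nsmul_eq_mul] at h2
  simp only [weight] at h ⊢
  push_cast at h2
  linarith

/-- The sum of the moduli of those coefficients in the aliasing class of `q` that the scheme
propagates with a wrong frequency. -/
noncomputable def aliasTail {N : ℕ} (a : (Fin 3 → ℤ) → ℂ) (q : Grid N) : ℝ :=
  ∑' m, if (fun i => (aliasFreq q m i : ℝ)) = freq3 q then 0 else ‖a (aliasFreq q m)‖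

lemma aliasTail_nonneg {N : ℕ} (a : (Fin 3 → ℤ) → ℂ) (q : Grid N) : 0 ≤ aliasTail a q :=
  tsum_nonneg fun m => by split_ifs <;> positivity

/-- The Fourier coefficients of an `H^r` function with `r > 3/2` are absolutely summable. -/
lemma summable_of_summable_weight {r : ℝ} (hr : 3 / 2 < r) {a : (Fin 3 → ℤ) → ℂ}
    (ha : Summable fun k => weight k ^ r * ‖a k‖ ^ 2) : Summable a := by
  refine Summable.of_norm_bounded ((summable_weight_rpow hr).add ha) fun k => ?_
  have hw : 0 < weight k ^ r := Real.rpow_pos_of_pos (weight_pos k) r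
  rw [Real.rpow_neg (weight_pos k).le]
  have : 2 * ‖a k‖ ≤ (weight k ^ r)⁻¹ + weight k ^ r * ‖a k‖ ^ 2 := by
    have h := sq_nonneg (weight k ^ r * ‖a k‖ - 1)
    have e : (weight k ^ r)⁻¹ + weight k ^ r * ‖a k‖ ^ 2 - 2 * ‖a k‖ =
        (weight k ^ r)⁻¹ * (weight k ^ r * ‖a k‖ - 1) ^ 2 := by
      field_simp
      ring
    nlinarith [mul_nonneg (inv_pos.2 hw).le h]
  linarith [norm_nonneg (a k)]

lemma summable_aliasTail {N : ℕ} (hN : 0 < N) {a : (Fin 3 → ℤ) → ℂ} (ha : Summable a)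
    (q : Grid N) :
    Summable fun m => if (fun i => (aliasFreq q m i : ℝ)) = freq3 q then (0 : ℝ)
      else ‖a (aliasFreq q m)‖ := by
  have h := ((Equiv.ofBijective _ (aliasFreq_bijective hN)).summable_iff.2 ha.norm).prod_factor q
  refine Summable.of_nonneg_of_le (fun m => by split_ifs <;> positivity) (fun m => ?_) h
  split_ifs
  exacts [norm_nonneg _, le_rfl]

/-- Cauchy–Schwarz on one aliasing class, against the weights `(1 + |m|²)^(-r)`: by
`sq_mul_weight_le`, `(1 + |k|²)^(-r) ≤ 30^r N^(-2r) (1 + |m|²)^(-r)` for the terms that count. -/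
lemma aliasTail_sq_le {r : ℝ} (hr : 3 / 2 < r) {N : ℕ} (hN : 0 < N) {a : (Fin 3 → ℤ) → ℂ}
    (ha : Summable fun k => weight k ^ r * ‖a k‖ ^ 2) (q : Grid N) :
    aliasTail a q ^ 2 ≤ (30 ^ r * ∑' m, weight m ^ (-r)) * ((N : ℝ) ^ (-r)) ^ 2 *
      ∑' m, weight (aliasFreq q m) ^ r * ‖a (aliasFreq q m)‖ ^ 2 := by
  have hN' : (0 : ℝ) < N := by exact_mod_cast hN
  set κ : ℝ := 30 ^ r * ((N : ℝ) ^ (-r)) ^ 2 with hκ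
  have hκ0 : 0 ≤ κ := by positivity
  set f : (Fin 3 → ℤ) → ℝ := fun m => √(κ * weight m ^ (-r)) with hf
  set g : (Fin 3 → ℤ) → ℝ :=
    fun m => √(weight (aliasFreq q m) ^ r * ‖a (aliasFreq q m)‖ ^ 2) with hg
  have hw (m : Fin 3 → ℤ) (s : ℝ) : 0 ≤ weight m ^ s := Real.rpow_nonneg (weight_pos m).le _
  have hf2 (m) : f m ^ (2 : ℝ) = κ * weight m ^ (-r) := by
    rw [Real.rpow_two, Real.sq_sqrt (mul_nonneg hκ0 (hw _ _))]
  have hg2 (m) : g m ^ (2 : ℝ) = weight (aliasFreq q m) ^ r * ‖a (aliasFreq q m)‖ ^ 2 := by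
    rw [Real.rpow_two, Real.sq_sqrt (mul_nonneg (hw _ _) (sq_nonneg _))]
  have hfs : Summable fun m => f m ^ (2 : ℝ) := by
    simp only [hf2]; exact (summable_weight_rpow hr).mul_left κ
  have hgs : Summable fun m => g m ^ (2 : ℝ) := by
    simp only [hg2]
    exact ((Equiv.ofBijective _ (aliasFreq_bijective hN)).summable_iff.2 ha).prod_factor q
  obtain ⟨hs, hle⟩ := Real.summable_and_inner_le_Lp_mul_Lq_tsum_of_nonneg
    Real.HolderConjugate.two_two (fun m => Real.sqrt_nonneg _) (fun m => Real.sqrt_nonneg _)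
    hfs hgs
  have hb (m) : (if (fun i => (aliasFreq q m i : ℝ)) = freq3 q then (0 : ℝ)
      else ‖a (aliasFreq q m)‖) ≤ f m * g m := by
    split_ifs with h
    · exact mul_nonneg (Real.sqrt_nonneg _) (Real.sqrt_nonneg _)
    · have h1 := sq_mul_weight_le q m ((freq3_eq_or_sq_le_weight q m).resolve_left h)
      rw [hf, hg, ← Real.sqrt_mul (mul_nonneg hκ0 (hw _ _))]
      refine Real.le_sqrt_of_sq_le ?_
      have h2 : 1 ≤ κ * weight m ^ (-r) * weight (aliasFreq q m) ^ r := by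
        have e : κ * weight m ^ (-r) * weight (aliasFreq q m) ^ r =
            (30 * weight (aliasFreq q m)) ^ r / ((N : ℝ) ^ 2 * weight m) ^ r := by
          rw [hκ, Real.mul_rpow (by norm_num) (weight_pos _).le,
            Real.mul_rpow (by positivity) (weight_pos _).le, Real.rpow_neg hN'.le,
            Real.rpow_neg (weight_pos m).le, ← Real.rpow_natCast_mul hN'.le, mul_comm _ r,
            Real.rpow_mul_natCast hN'.le]
          field_simp
        rw [e, one_le_div (Real.rpow_pos_of_pos (mul_pos (by positivity) (weight_pos m)) r)]
        exact Real.rpow_le_rpow (mul_pos (by positivity) (weight_pos m)).le h1 (by linarith)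
      nlinarith [mul_le_mul_of_nonneg_right h2 (sq_nonneg ‖a (aliasFreq q m)‖)]
  have hle2 : aliasTail a q ≤
      (∑' m, f m ^ (2 : ℝ)) ^ (1 / (2 : ℝ)) * (∑' m, g m ^ (2 : ℝ)) ^ (1 / (2 : ℝ)) :=
    ((summable_aliasTail hN (summable_of_summable_weight hr ha) q).tsum_le_tsum hb hs).trans hle
  refine (pow_le_pow_left₀ (aliasTail_nonneg a q) hle2 2).trans (le_of_eq ?_)
  rw [← Real.sqrt_eq_rpow, ← Real.sqrt_eq_rpow, mul_pow,
    Real.sq_sqrt (tsum_nonneg fun m => by rw [hf2]; exact mul_nonneg hκ0 (hw _ _)),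
    Real.sq_sqrt (tsum_nonneg fun m => by rw [hg2]; exact mul_nonneg (hw _ _) (sq_nonneg _))]
  simp only [hf2, hg2, tsum_mul_left]
  rw [hκ]
  ring

lemma sum_aliasTail_sq_le {r : ℝ} (hr : 3 / 2 < r) {N : ℕ} (hN : 0 < N) {a : (Fin 3 → ℤ) → ℂ}
    (ha : Summable fun k => weight k ^ r * ‖a k‖ ^ 2) :
    ∑ q : Grid N, aliasTail a q ^ 2 ≤ (30 ^ r * ∑' m, weight m ^ (-r)) * ((N : ℝ) ^ (-r)) ^ 2 *
      ∑' k, weight k ^ r * ‖a k‖ ^ 2 := by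
  let e := Equiv.ofBijective _ (aliasFreq_bijective hN)
  have h1 : ∑' k, weight k ^ r * ‖a k‖ ^ 2 =
      ∑ q : Grid N, ∑' m, weight (aliasFreq q m) ^ r * ‖a (aliasFreq q m)‖ ^ 2 := by
    have h := (e.summable_iff.2 ha).tsum_prod
    rw [← e.tsum_eq]
    exact h.trans (tsum_fintype _)
  rw [h1, Finset.mul_sum]
  exact Finset.sum_le_sum fun q _ => aliasTail_sq_le hr hN ha q

/-! ### The error of the scheme -/

/-- Applying a frequency-dependent matrix after aliasing, at the grid frequency, instead of before,
at the true frequencies, affects only the coefficients counted by `aliasTail`. -/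
lemma norm_mulVec_tsum_sub_le {N : ℕ} (hN : 0 < N) (P : (Fin 3 → ℝ) → Matrix (Fin 3) (Fin 3) ℂ)
    (hP : ∀ ω i j, ‖P ω i j‖ ≤ 7) {A : (Fin 3 → ℤ) → Fin 3 → ℂ}
    (hA : ∀ j, Summable fun k => A k j) (q : Grid N) (i : Fin 3) :
    Summable (fun m => (P (fun i => (aliasFreq q m i : ℝ)) *ᵥ A (aliasFreq q m)) i) ∧
    ‖(P (freq3 q) *ᵥ fun j => ∑' m, A (aliasFreq q m) j) i -
        ∑' m, (P (fun i => (aliasFreq q m i : ℝ)) *ᵥ A (aliasFreq q m)) i‖ ≤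
      14 * ∑ j, aliasTail (fun k => A k j) q := by
  have hs (j : Fin 3) : Summable fun m => A (aliasFreq q m) j :=
    ((Equiv.ofBijective _ (aliasFreq_bijective hN)).summable_iff.2 (hA j)).prod_factor q
  have hPs (j : Fin 3) :
      Summable fun m => P (fun i => (aliasFreq q m i : ℝ)) i j * A (aliasFreq q m) j :=
    Summable.of_norm_bounded ((hs j).norm.mul_left 7) fun m => by
      rw [norm_mul]
      exact mul_le_mul_of_nonneg_right (hP _ _ _) (norm_nonneg _)
  simp only [Matrix.mulVec, dotProduct]
  refine ⟨summable_sum fun j _ => hPs j, ?_⟩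
  rw [Summable.tsum_finsetSum fun j _ => hPs j, ← Finset.sum_sub_distrib, Finset.mul_sum]
  refine (norm_sum_le _ _).trans (Finset.sum_le_sum fun j _ => ?_)
  rw [← tsum_mul_left, ← ((hs j).mul_left _).tsum_sub (hPs j), aliasTail, ← tsum_mul_left]
  refine tsum_of_norm_bounded ((summable_aliasTail hN (hA j) q).mul_left 14).hasSum fun m => ?_
  split_ifs with h
  · simp [h]
  · rw [← sub_mul, norm_mul]
    refine mul_le_mul_of_nonneg_right ((norm_sub_le _ _).trans ?_) (norm_nonneg _)
    -- `14 = 7 + 7` bounds the difference of two entries.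
    linarith [hP (freq3 q) i j, hP (fun i => (aliasFreq q m i : ℝ)) i j]

/-- The squared `H^r` size of a family of vectors of Fourier coefficients. -/
noncomputable def coefNormSq (r : ℝ) (A : (Fin 3 → ℤ) → Fin 3 → ℂ) : ℝ :=
  ∑ j, ∑' k, weight k ^ r * ‖A k j‖ ^ 2

/-- The constant is `3528 = 3 · 1176`, one contribution for each component of `Y`. -/
lemma sum_sq_le_of_norm_le {r : ℝ} (hr : 3 / 2 < r) {N : ℕ} (hN : 0 < N)
    {A B : (Fin 3 → ℤ) → Fin 3 → ℂ} (hA : ∀ j, Summable fun k => weight k ^ r * ‖A k j‖ ^ 2)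
    (hB : ∀ j, Summable fun k => weight k ^ r * ‖B k j‖ ^ 2) {Y : GridField N}
    (hY : ∀ i q, ‖Y i q‖ ≤ 14 * ∑ j, aliasTail (fun k => A k j) q +
      14 * ∑ j, aliasTail (fun k => B k j) q) :
    ∑ i, ∑ q, ‖Y i q‖ ^ 2 ≤ 3528 * (30 ^ r * ∑' m, weight m ^ (-r)) * ((N : ℝ) ^ (-r)) ^ 2 *
      (coefNormSq r A + coefNormSq r B) := by
  -- `1176 = 2 · 3 · 14²`: two sums of three terms each, with the factor `14`.
  have h1 (i : Fin 3) (q : Grid N) : ‖Y i q‖ ^ 2 ≤ 1176 * ∑ j,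
      (aliasTail (fun k => A k j) q ^ 2 + aliasTail (fun k => B k j) q ^ 2) := by
    have h2 := pow_le_pow_left₀ (norm_nonneg _) (hY i q) 2
    have hcs (x : Fin 3 → ℝ) : (∑ j, x j) ^ 2 ≤ 3 * ∑ j, x j ^ 2 := by
      simpa using sq_sum_le_card_mul_sum_sq (s := Finset.univ) (f := x)
    have h3 := hcs fun j => aliasTail (fun k => A k j) q
    have h4 := hcs fun j => aliasTail (fun k => B k j) q
    rw [Finset.sum_add_distrib]
    nlinarith [sq_nonneg ((∑ j, aliasTail (fun k => A k j) q) -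
      ∑ j, aliasTail (fun k => B k j) q)]
  have h5 (i : Fin 3) : ∑ q, ‖Y i q‖ ^ 2 ≤
      1176 * ((30 ^ r * ∑' m, weight m ^ (-r)) * ((N : ℝ) ^ (-r)) ^ 2 *
        (coefNormSq r A + coefNormSq r B)) := by
    refine (Finset.sum_le_sum fun q _ => h1 i q).trans ?_
    rw [← Finset.mul_sum, Finset.sum_comm]
    refine mul_le_mul_of_nonneg_left ?_ (by norm_num)
    rw [coefNormSq, coefNormSq, ← Finset.sum_add_distrib, Finset.mul_sum]
    refine Finset.sum_le_sum fun j _ => ?_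
    rw [Finset.sum_add_distrib, mul_add]
    exact add_le_add (sum_aliasTail_sq_le hr hN (hA j)) (sum_aliasTail_sq_le hr hN (hB j))
  refine (Finset.sum_le_sum fun i _ => h5 i).trans (le_of_eq ?_)
  simp only [Finset.sum_const, Finset.card_univ, Fintype.card_fin, nsmul_eq_mul]
  push_cast
  ring

lemma dft3_smul {N : ℕ} (c : ℂ) (U : GridField N) : dft3 (c • U) = c • dft3 U := by
  ext i : 1
  simp only [dft3, Pi.smul_apply, Matrix.mulVec_smul]

lemma idft3_smul {N : ℕ} (c : ℂ) (U : GridField N) : idft3 (c • U) = c • idft3 U := by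
  ext i : 1
  simp only [idft3, Pi.smul_apply, Matrix.mulVec_smul]

lemma idft3_sub {N : ℕ} (U V : GridField N) : idft3 (U - V) = idft3 U - idft3 V :=
  funext fun _ => Matrix.mulVec_sub _ _ _

lemma mul_discreteNormSq {N : ℕ} {c : ℝ} (hc : 0 ≤ c) (U : GridField N) :
    c * discreteNormSq U = discreteNormSq ((√c : ℂ) • U) := by
  have h (i : Fin 3) (p : Grid N) : ‖((√c : ℂ) • U) i p‖ ^ 2 = c * ‖U i p‖ ^ 2 := by
    simp only [Pi.smul_apply, smul_eq_mul, norm_mul, Complex.norm_real, mul_pow]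
    rw [Real.norm_of_nonneg (Real.sqrt_nonneg c), Real.sq_sqrt hc]
  simp only [discreteNormSq, h, ← Finset.mul_sum]
  ring

/-- The sums of a family of Fourier coefficients over the aliasing classes of the grid. -/
noncomputable def aliasSum {N : ℕ} (A : (Fin 3 → ℤ) → Fin 3 → ℂ) : GridField N :=
  fun i q => ∑' m, A (aliasFreq q m) i

lemma summable_fourierVec {r : ℝ} (hr : 3 / 2 < r) {U : VField} (hU : MemSobolevVec r U)
    (j : Fin 3) : Summable fun k => fourierVec U k j :=
  summable_of_summable_weight hr (hU j).summable

lemma smul_sample {r : ℝ} (hr : 3 / 2 < r) {N : ℕ} (hN : 0 < N) {U : VField}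
    (hU : MemSobolevVec r U) (hc : Continuous U) (c : ℝ) :
    (c : ℂ) • sample N U = idft3 ((N : ℂ) ^ 3 • aliasSum fun k => c • fourierVec U k) := by
  rw [sample_eq_idft3 hN (fun i => (hU i).periodic) (fun i => (continuous_pi_iff.1 hc) i)
    (summable_fourierVec hr hU), ← idft3_smul, smul_comm]
  congr 2
  ext i q
  simp [aliasSum, tsum_mul_left]

/-- The output of the scheme in the scaled unknowns: the matrices act on the aliased initial
coefficients, since the DFT undoes the inverse DFT in `smul_sample`. -/
lemma smul_schemeH {μ ε r T : ℝ} (hμ : 0 < μ) (hr : 3 / 2 < r) {N : ℕ} (hN : 0 < N)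
    {H₀ E₀ : VField} (hH : MemSobolevVec r H₀) (hHc : Continuous H₀) (hE : MemSobolevVec r E₀)
    (hEc : Continuous E₀) :
    (√μ : ℂ) • schemeH μ ε T N H₀ E₀ = idft3 ((N : ℂ) ^ 3 • ((fun i q =>
      (cosCoef (T / √(μ * ε)) (freq3 q) *ᵥ
        fun a => aliasSum (fun k => √μ • fourierVec H₀ k) a q) i -
      (sinCoef (T / √(μ * ε)) (freq3 q) *ᵥ
        fun a => aliasSum (fun k => √ε • fourierVec E₀ k) a q) i) : GridField N)) := by
  have hsμ : (√μ : ℂ) ≠ 0 := by exact_mod_cast (Real.sqrt_pos.2 hμ).ne'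
  have h1 := congrArg dft3 (smul_sample hr hN hH hHc √μ)
  have h2 := congrArg dft3 (smul_sample hr hN hE hEc √ε)
  rw [dft3_idft3, dft3_smul] at h1 h2
  simp only [schemeH]
  rw [← idft3_smul]
  congr 1
  ext i p
  have h3 (a : Fin 3) := congrFun (congrFun h1 a) p
  have h4 (a : Fin 3) := congrFun (congrFun h2 a) p
  simp only [Pi.smul_apply, smul_eq_mul] at h3 h4 ⊢
  rw [mul_inv_cancel_left₀ hsμ]
  simp only [Matrix.mulVec, dotProduct, mul_sub, Finset.mul_sum]
  refine congrArg₂ _ (Finset.sum_congr rfl fun a _ => ?_) (Finset.sum_congr rfl fun a _ => ?_)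
  · rw [mul_left_comm, h3, mul_left_comm]
  · rw [mul_left_comm, h4, mul_left_comm]

lemma smul_schemeE {μ ε r T : ℝ} (hε : 0 < ε) (hr : 3 / 2 < r) {N : ℕ} (hN : 0 < N)
    {H₀ E₀ : VField} (hH : MemSobolevVec r H₀) (hHc : Continuous H₀) (hE : MemSobolevVec r E₀)
    (hEc : Continuous E₀) :
    (√ε : ℂ) • schemeE μ ε T N H₀ E₀ = idft3 ((N : ℂ) ^ 3 • ((fun i q =>
      (cosCoef (T / √(μ * ε)) (freq3 q) *ᵥ
        fun a => aliasSum (fun k => √ε • fourierVec E₀ k) a q) i +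
      (sinCoef (T / √(μ * ε)) (freq3 q) *ᵥ
        fun a => aliasSum (fun k => √μ • fourierVec H₀ k) a q) i) : GridField N)) := by
  have hsε : (√ε : ℂ) ≠ 0 := by exact_mod_cast (Real.sqrt_pos.2 hε).ne'
  have h1 := congrArg dft3 (smul_sample hr hN hH hHc √μ)
  have h2 := congrArg dft3 (smul_sample hr hN hE hEc √ε)
  rw [dft3_idft3, dft3_smul] at h1 h2
  simp only [schemeE]
  rw [← idft3_smul]
  congr 1
  ext i p
  have h3 (a : Fin 3) := congrFun (congrFun h1 a) p
  have h4 (a : Fin 3) := congrFun (congrFun h2 a) p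
  simp only [Pi.smul_apply, smul_eq_mul] at h3 h4 ⊢
  rw [mul_inv_cancel_left₀ hsε]
  simp only [Matrix.mulVec, dotProduct, mul_add, Finset.mul_sum]
  refine congrArg₂ _ (Finset.sum_congr rfl fun a _ => ?_) (Finset.sum_congr rfl fun a _ => ?_)
  · rw [mul_left_comm, h4, mul_left_comm]
  · rw [mul_left_comm, h3, mul_left_comm]

lemma coefNormSq_smul_fourierVec_le {r M c : ℝ} (hc : 0 ≤ c) {U : VField}
    (hM : sobolevNorm r U ≤ M) :
    coefNormSq r (fun k => √c • fourierVec U k) ≤ c * M ^ 2 := by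
  have h0 : 0 ≤ ∑ i, ∑' k, sobolevTerm r (fun x => U x i) k :=
    Finset.sum_nonneg fun i _ => tsum_nonneg (sobolevTerm_nonneg r _)
  have h1 : coefNormSq r (fun k => √c • fourierVec U k) =
      c * ∑ i, ∑' k, sobolevTerm r (fun x => U x i) k := by
    rw [coefNormSq, Finset.mul_sum]
    refine Finset.sum_congr rfl fun i _ => ?_
    rw [← tsum_mul_left]
    refine tsum_congr fun k => ?_
    rw [Pi.smul_apply, norm_smul, mul_pow, Real.norm_of_nonneg (Real.sqrt_nonneg c),
      Real.sq_sqrt hc, sobolevTerm, fourierVec, weight]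
    ring
  rw [h1]
  refine mul_le_mul_of_nonneg_left ?_ hc
  have h2 : √(∑ i, ∑' k, sobolevTerm r (fun x => U x i) k) ≤ M := hM
  calc _ = √(∑ i, ∑' k, sobolevTerm r (fun x => U x i) k) ^ 2 := (Real.sq_sqrt h0).symm
    _ ≤ M ^ 2 := pow_le_pow_left₀ (Real.sqrt_nonneg _) h2 2

lemma MemSobolevVec.summable_smul_fourierVec {r : ℝ} {U : VField} (hU : MemSobolevVec r U) (c : ℝ)
    (j : Fin 3) : Summable fun k => weight k ^ r * ‖(c • fourierVec U k) j‖ ^ 2 := by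
  refine ((hU j).summable.mul_left (c ^ 2)).congr fun k => ?_
  rw [Pi.smul_apply, norm_smul, mul_pow, Real.norm_eq_abs, sq_abs, sobolevTerm, fourierVec, weight]
  ring

/-- The squared energy norm of the error is bounded by aliasing errors of the initial values. -/
lemma IsMaxwellSolution.error_sq_le {μ ε r T M : ℝ} (hμ : 0 < μ) (hε : 0 < ε) (hr : 3 / 2 < r)
    (hT : 0 < T) {H E : ℝ → VField} (h : IsMaxwellSolution μ ε r T H E)
    (hHM : sobolevNorm r (H 0) ≤ M) (hEM : sobolevNorm r (E 0) ≤ M) {N : ℕ} (hN : 0 < N) :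
    μ * discreteNormSq (schemeH μ ε T N (H 0) (E 0) - sample N (H T))
        + ε * discreteNormSq (schemeE μ ε T N (H 0) (E 0) - sample N (E T)) ≤
      7056 * (30 ^ r * ∑' m, weight m ^ (-r)) * ((N : ℝ) ^ (-r)) ^ 2 * ((μ + ε) * M ^ 2) := by
  have hform := h.fourierVec_eq hμ hε (by linarith) hT
  obtain ⟨hcont, Ht, Et, hH, hE, -⟩ := h
  have m0 : (0 : ℝ) ∈ Set.Icc 0 T := Set.left_mem_Icc.2 hT.le
  have mT : T ∈ Set.Icc 0 T := Set.right_mem_Icc.2 hT.le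
  set κ := T / √(μ * ε) with hκ
  set A : (Fin 3 → ℤ) → Fin 3 → ℂ := fun k => √μ • fourierVec (H 0) k with hA
  set B : (Fin 3 → ℤ) → Fin 3 → ℂ := fun k => √ε • fourierVec (E 0) k with hB
  have hAw := (hH.mem 0 m0).summable_smul_fourierVec √μ
  have hBw := (hE.mem 0 m0).summable_smul_fourierVec √ε
  have hAs (j : Fin 3) : Summable fun k => A k j := summable_of_summable_weight hr (hAw j)
  have hBs (j : Fin 3) : Summable fun k => B k j := summable_of_summable_weight hr (hBw j)
  have hcos (ω i j) : ‖cosCoef κ ω i j‖ ≤ 7 := norm_cosCoef_apply_le κ ω i j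
  have hsin (ω i j) : ‖sinCoef κ ω i j‖ ≤ 7 :=
    (norm_sinCoef_apply_le κ ω i j).trans (by norm_num)
  rw [mul_discreteNormSq hμ.le, mul_discreteNormSq hε.le, smul_sub, smul_sub,
    smul_schemeH hμ hr hN (hH.mem 0 m0) (hcont 0 m0).1 (hE.mem 0 m0) (hcont 0 m0).2,
    smul_schemeE hε hr hN (hH.mem 0 m0) (hcont 0 m0).1 (hE.mem 0 m0) (hcont 0 m0).2,
    smul_sample hr hN (hH.mem T mT) (hcont T mT).1, smul_sample hr hN (hE.mem T mT) (hcont T mT).2,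
    ← idft3_sub, ← idft3_sub, ← smul_sub, ← smul_sub, discreteNormSq_idft3 hN,
    discreteNormSq_idft3 hN]
  simp only [(hform _).1, (hform _).2, ← hκ]
  have hbH := sum_sq_le_of_norm_le hr hN hAw hBw (Y := (fun i q =>
      (cosCoef κ (freq3 q) *ᵥ fun a => aliasSum A a q) i -
      (sinCoef κ (freq3 q) *ᵥ fun a => aliasSum B a q) i : GridField N) -
      aliasSum fun k => cosCoef κ (fun i => (k i : ℝ)) *ᵥ A k -
        sinCoef κ (fun i => (k i : ℝ)) *ᵥ B k) fun i q => by
    have h1 := norm_mulVec_tsum_sub_le hN (cosCoef κ) hcos hAs q i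
    have h2 := norm_mulVec_tsum_sub_le hN (sinCoef κ) hsin hBs q i
    simp only [Pi.sub_apply, aliasSum]
    rw [h1.1.tsum_sub h2.1, sub_sub_sub_comm]
    exact (norm_sub_le _ _).trans (add_le_add h1.2 h2.2)
  have hbE := sum_sq_le_of_norm_le hr hN hBw hAw (Y := (fun i q =>
      (cosCoef κ (freq3 q) *ᵥ fun a => aliasSum B a q) i +
      (sinCoef κ (freq3 q) *ᵥ fun a => aliasSum A a q) i : GridField N) -
      aliasSum fun k => cosCoef κ (fun i => (k i : ℝ)) *ᵥ B k +
        sinCoef κ (fun i => (k i : ℝ)) *ᵥ A k) fun i q => by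
    have h1 := norm_mulVec_tsum_sub_le hN (cosCoef κ) hcos hBs q i
    have h2 := norm_mulVec_tsum_sub_le hN (sinCoef κ) hsin hAs q i
    simp only [Pi.sub_apply, Pi.add_apply, aliasSum]
    rw [h1.1.tsum_add h2.1, add_sub_add_comm]
    exact (norm_add_le _ _).trans (add_le_add h1.2 h2.2)
  refine (add_le_add hbH hbE).trans ?_
  have hAM := coefNormSq_smul_fourierVec_le hμ.le hHM
  have hBM := coefNormSq_smul_fourierVec_le hε.le hEM
  have hw : 0 ≤ ∑' m, weight m ^ (-r) :=
    tsum_nonneg fun m => Real.rpow_nonneg (weight_pos m).le _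
  have hK : 0 ≤ 3528 * (30 ^ r * ∑' m, weight m ^ (-r)) * ((N : ℝ) ^ (-r)) ^ 2 := by positivity
  have := mul_le_mul_of_nonneg_left (add_le_add hAM hBM) hK
  linarith

end MaxwellFourier

theorem mainTheorem1 (r : ℝ) (hr : 3 / 2 < r) (M : ℝ) :
    ∃ C : ℝ, 0 < C ∧
      ∀ (μ ε T : ℝ), 0 < μ → 0 < ε → 0 < T →
      ∀ H E : ℝ → VField, IsMaxwellSolution μ ε r T H E →
        sobolevNorm r (H 0) ≤ M → sobolevNorm r (E 0) ≤ M →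
      ∀ N : ℕ, 0 < N → Even N →
        √(μ * discreteNormSq (schemeH μ ε T N (H 0) (E 0) - sample N (H T))
          + ε * discreteNormSq (schemeE μ ε T N (H 0) (E 0) - sample N (E T)))
          ≤ C * (√μ + √ε) * (N : ℝ) ^ (-r) := by
  set K : ℝ := 7056 * (30 ^ r * ∑' m, weight m ^ (-r)) with hK
  have hw : 0 ≤ ∑' m, weight m ^ (-r) :=
    tsum_nonneg fun m => Real.rpow_nonneg (weight_pos m).le _
  have hK0 : 0 ≤ K := by positivity
  -- Adding `1` keeps the constant positive when `M = 0`.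
  refine ⟨√K * |M| + 1, by positivity, ?_⟩
  intro μ ε T hμ hε hT H E h hHM hEM N hN _
  have herr := h.error_sq_le hμ hε hr hT hHM hEM hN
  have hNr : 0 ≤ (N : ℝ) ^ (-r) := by positivity
  refine (Real.sqrt_le_left (by positivity)).2 (herr.trans ?_)
  have h1 : μ + ε ≤ (√μ + √ε) ^ 2 := by
    nlinarith [Real.sq_sqrt hμ.le, Real.sq_sqrt hε.le, Real.sqrt_nonneg μ, Real.sqrt_nonneg ε,
      mul_nonneg (Real.sqrt_nonneg μ) (Real.sqrt_nonneg ε)]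
  calc K * ((N : ℝ) ^ (-r)) ^ 2 * ((μ + ε) * M ^ 2)
      ≤ K * ((N : ℝ) ^ (-r)) ^ 2 * ((√μ + √ε) ^ 2 * M ^ 2) := by gcongr
    _ = (√K * |M| * (√μ + √ε) * (N : ℝ) ^ (-r)) ^ 2 := by
        rw [mul_pow, mul_pow, mul_pow, Real.sq_sqrt hK0, sq_abs]
        ring
    _ ≤ ((√K * |M| + 1) * (√μ + √ε) * (N : ℝ) ^ (-r)) ^ 2 := by
        gcongr
        linarith
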